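/- Let $\alpha\in[0,1]$ and let $m\ge 1$ be an integer. The sequential preferential attachment graph is the following random increasing sequence of multigraphs $G_1\subset G_2\subset\cdots$, where $G_n$ has vertex set $\{1,\dots,n\}$. The graph $G_1$ is the vertex $1$ without edges. For $n\ge 2$, $G_n$ arises from $G_{n-1}$ by adding the vertex $n$ and, one after the other, $m$ edges from $n$ to vertices $v_1,\dots,v_m\in\{1,\dots,n-1\}$, not necessarily distinct. Given $G_{n-1}$ and $v_1,\dots,v_{i-1}$, the vertex $v_i$ is, with probability $$\alpha_n(i)=\alpha\,\frac{2m(n-1)}{2m(n-2)+2m\alpha+(1-\alpha)(i-1)},$$ chosen uniformly from $\{1,\dots,n-1\}$, and with probability $1-\alpha_n(i)$ chosen in proportion to the current degrees, that is, equal to $k$ with probability $$\frac{\deg_{G_{n-1}}(k)+|\{1\le j\le i-1: v_j=k\}|}{2m(n-2)+i-1}.$$ (For $n=2$ necessarily $v_1=1$.) Fix an integer $r\ge 0$. A cycle of length $l\ge 2$ in a multigraph consists of $l$ distinct edges joining $l$ distinct vertices in cyclic order; two parallel edges form a cycle of length $2$, and cycles with different edge sets are different. Call cycles of length at most $2r$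 short, and let the distance of two cycles be the minimal graph distance between a vertex of the one and a vertex of the other. Two short cycles are equivalent if they are joined by a finite chain of short cycles in which consecutive ones are at distance at most $r$. A multicycle is the union of the cycles of an equivalence class that contains at least two short cycles. A new multicycle is created at step $n$ if some multicycle of $G_n$ is not a multicycle of $G_{n-1}$. Lemma. (i) For every $\varepsilon>0$ there exists $N=N(\varepsilon)$ (depending also on $\alpha,m,r$) such that for every $n>N$ the probability that a new multicycle is created at step $n$ is less than $\varepsilon$. (ii) If $\alpha>0$, then for every $\varepsilon>0$ there exists $N=N(\varepsilon)$ (depending also on $\alpha,m,r$) such that the probability that a new multicycle is created at any step $n>N$ at all is less than $\varepsilon$. -/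

import Mathlib

open MeasureTheory ProbabilityTheory

namespace PrefAttach

/-! ### The sequential preferential attachment model

The vertices are `1, 2, 3, …`. Vertex `1` starts without edges, and each vertex `n ≥ 2` sends `m`
edges, one after the other, to vertices of `{1, …, n - 1}`. All edges are numbered `0, 1, 2, …` in
the order in which they are attached, so that the edge number `e` is the edge number `e % m + 1`
among the `m` edges sent by the vertex `e / m + 2`. -/

/-- The vertex that sends the edge number `e`. -/
def source (m e : ℕ) : ℕ := e / m + 2

/-- The possible choices for the target of the edge number `e`: the vertices
`1, …, source m e - 1`. The element `k` of `Fin (e / m + 1)` stands for the vertex `k + 1`. -/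
abbrev Choice (m e : ℕ) : Type := Fin (e / m + 1)

/-- The vertex that a choice stands for. -/
def target {m e : ℕ} (k : Choice m e) : ℕ := k + 1

/-- The targets of the edges number `0, …, e`. -/
abbrev History (m e : ℕ) : Type := (j : Finset.Iic e) → Choice m j

/-- The targets of all edges. -/
abbrev Attachments (m : ℕ) : Type := (e : ℕ) → Choice m e

/-- Degree of the vertex `v` in the multigraph with the edges number `0, …, e`, where an edge that
is sent by the vertex `source m (e + 1)`, to which the next edge belongs, counts only at its
target. At the vertices `v < source m (e + 1)`, the only ones at which it is used, this is the usual
degree. -/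
def degree {m e : ℕ} (h : History m e) (v : ℕ) : ℕ :=
  ∑ j : Finset.Iic e, ((if source m j = v then 1 else 0) + (if target (h j) = v then 1 else 0))

/-- The coefficient `α_n(i)` of the uniform rule, for the `i`-th edge of the vertex `n`. -/
noncomputable def uniformCoeff (α : ℝ) (m n i : ℕ) : ℝ :=
  α * (2 * m * ((n : ℝ) - 1)) /
    (2 * m * ((n : ℝ) - 2) + 2 * m * α + (1 - α) * ((i : ℝ) - 1))

/-- The conditional probability, given the targets of the edges number `0, …, e`, that the edge
number `e + 1`, which is the `i`-th edge of the vertex `n`, is attached to the vertex `v`: with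
probability `α_n(i)` a uniform choice from `{1, …, n - 1}`, and otherwise a choice in proportion to
the current degrees, whose sum is `2m(n - 2) + i - 1`. -/
noncomputable def attachProb (α : ℝ) {m e : ℕ} (h : History m e) (v : ℕ) : ℝ :=
  let n : ℕ := source m (e + 1)
  let i : ℕ := (e + 1) % m + 1
  uniformCoeff α m n i * (1 / ((n : ℝ) - 1)) +
    (1 - uniformCoeff α m n i) * (degree h v / (2 * m * ((n : ℝ) - 2) + ((i : ℝ) - 1)))

theorem uniformCoeff_mem (α : unitInterval) (m e : ℕ) :
    uniformCoeff α m (source m e) (e % m + 1) ∈ Set.Icc (0 : ℝ) 1 := by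
  obtain ⟨a, ha0, ha1⟩ := α
  have hq : (0 : ℝ) ≤ ((e / m : ℕ) : ℝ) := Nat.cast_nonneg _
  have hm : (0 : ℝ) ≤ (m : ℝ) := Nat.cast_nonneg _
  have hi : (0 : ℝ) ≤ ((e % m : ℕ) : ℝ) := Nat.cast_nonneg _
  have h1 : 0 ≤ (m : ℝ) * ((e / m : ℕ) : ℝ) := mul_nonneg hm hq
  have h2 : 0 ≤ (1 - a) * ((e % m : ℕ) : ℝ) := mul_nonneg (by linarith) hi
  have h3 : 0 ≤ (m : ℝ) * a := mul_nonneg hm ha0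
  have h4 : 0 ≤ (1 - a) * ((m : ℝ) * ((e / m : ℕ) : ℝ)) := mul_nonneg (by linarith) h1
  have h5 : 0 ≤ a * ((m : ℝ) * ((e / m : ℕ) : ℝ)) := mul_nonneg ha0 h1
  simp only [uniformCoeff, source]
  push_cast
  constructor
  · apply div_nonneg <;> nlinarith
  · apply div_le_one_of_le₀ <;> nlinarith

theorem attachProb_nonneg (α : unitInterval) {m e : ℕ} (h : History m e) (v : ℕ) :
    0 ≤ attachProb α h v := by
  obtain ⟨h0, h1⟩ := uniformCoeff_mem α m (e + 1)
  have hm : (0 : ℝ) ≤ (m : ℝ) := Nat.cast_nonneg _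
  have hq : (0 : ℝ) ≤ (((e + 1) / m : ℕ) : ℝ) := Nat.cast_nonneg _
  have hi : (0 : ℝ) ≤ (((e + 1) % m : ℕ) : ℝ) := Nat.cast_nonneg _
  have hn : (source m (e + 1) : ℝ) = (((e + 1) / m : ℕ) : ℝ) + 2 := by simp [source]
  refine add_nonneg (mul_nonneg h0 (one_div_nonneg.2 (by rw [hn]; linarith)))
    (mul_nonneg (by linarith) (div_nonneg (Nat.cast_nonneg _) ?_))
  have : 0 ≤ (m : ℝ) * (((e + 1) / m : ℕ) : ℝ) := mul_nonneg hm hq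
  rw [hn]
  push_cast at this hi ⊢
  nlinarith

theorem sum_degree {m e : ℕ} (h : History m e) :
    ∑ k : Choice m (e + 1), degree h (target k) = m * ((e + 1) / m) + (e + 1) := by
  have key1 : ∀ j : ℕ, (∑ k : Choice m (e + 1), if source m j = target k then 1 else 0)
      = if j < m * ((e + 1) / m) then 1 else 0 := by
    intro j
    rcases Nat.eq_zero_or_pos m with rfl | hm
    · rw [Nat.zero_mul, if_neg (Nat.not_lt_zero _)]
      refine Finset.sum_eq_zero fun k _ => if_neg fun hk => ?_
      have hk2 := k.2
      simp only [source, target, Nat.div_zero] at hk hk2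
      omega
    · have hiff : j < m * ((e + 1) / m) ↔ j / m < (e + 1) / m := by
        rw [Nat.div_lt_iff_lt_mul hm, mul_comm]
      rw [if_congr hiff rfl rfl]
      split_ifs with hj
      · rw [Finset.sum_eq_single (⟨j / m + 1, by omega⟩ : Choice m (e + 1))]
        · exact if_pos rfl
        · intro k _ hk
          refine if_neg fun hk' => hk (Fin.ext ?_)
          simp only [source, target] at hk' ⊢
          omega
        · exact fun hk => absurd (Finset.mem_univ _) hk
      · refine Finset.sum_eq_zero fun k _ => if_neg fun hk => hj ?_
        have hk2 := k.2
        simp only [source, target] at hk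
        omega
  have key2 : ∀ j : Finset.Iic e,
      (∑ k : Choice m (e + 1), if target (h j) = target k then 1 else 0) = 1 := by
    intro j
    have hj : (j : ℕ) ≤ e := Finset.mem_Iic.1 j.2
    have hle : (j : ℕ) / m ≤ (e + 1) / m := Nat.div_le_div_right (by omega)
    have h2 := (h j).2
    rw [Finset.sum_eq_single (⟨(h j : ℕ), by omega⟩ : Choice m (e + 1))]
    · exact if_pos rfl
    · intro k _ hk
      refine if_neg fun hk' => hk (Fin.ext ?_)
      simp only [target] at hk' ⊢
      omega
    · exact fun hk => absurd (Finset.mem_univ _) hk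
  simp only [degree]
  rw [Finset.sum_comm, Finset.sum_congr rfl fun j _ => by
    rw [Finset.sum_add_distrib, key1 j, key2 j]]
  rw [Finset.sum_add_distrib,
    Finset.sum_coe_sort (Finset.Iic e) fun j => if j < m * ((e + 1) / m) then 1 else 0,
    Finset.sum_ite, Finset.sum_const_zero, add_zero, ← Finset.card_eq_sum_ones]
  have hle := Nat.mul_div_le (e + 1) m
  rw [show (Finset.Iic e).filter (fun j => j < m * ((e + 1) / m))
      = Finset.range (m * ((e + 1) / m)) by
    ext j; simp only [Finset.mem_filter, Finset.mem_Iic, Finset.mem_range]; omega]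
  simp

theorem sum_attachProb (α : ℝ) {m e : ℕ} (h : History m e) :
    ∑ k : Choice m (e + 1), attachProb α h (target k) = 1 := by
  have hdiv := Nat.div_add_mod (e + 1) m
  have hs := sum_degree h
  simp only [attachProb]
  rw [Finset.sum_add_distrib, ← Finset.mul_sum, ← Finset.mul_sum, Finset.sum_const,
    ← Finset.sum_div, ← Nat.cast_sum, hs]
  have hD : ((m * ((e + 1) / m) + (e + 1) : ℕ) : ℝ)
      = 2 * m * ((source m (e + 1) : ℝ) - 2) + ((((e + 1) % m + 1 : ℕ) : ℝ) - 1) := by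
    have : m * ((e + 1) / m) + (e + 1) = 2 * m * ((e + 1) / m) + (e + 1) % m := by
      linarith
    rw [this]
    simp only [source, Nat.cast_add, Nat.cast_mul, Nat.cast_ofNat, Nat.cast_one]
    ring
  have hpos : (0 : ℝ) < ((m * ((e + 1) / m) + (e + 1) : ℕ) : ℝ) := by
    exact_mod_cast Nat.add_pos_right _ (Nat.succ_pos e)
  rw [← hD, div_self hpos.ne', Finset.card_univ, Fintype.card_fin, nsmul_eq_mul]
  have hn : (source m (e + 1) : ℝ) - 1 = (((e + 1) / m + 1 : ℕ) : ℝ) := by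
    simp only [source, Nat.cast_add, Nat.cast_ofNat, Nat.cast_one]
    ring
  have hne : ((((e + 1) / m + 1 : ℕ)) : ℝ) ≠ 0 := Nat.cast_ne_zero.2 (Nat.succ_ne_zero _)
  rw [hn, mul_one_div_cancel hne]
  ring

/-- The conditional law of the target of the edge number `e + 1`, given the earlier targets. -/
noncomputable def attachPMF (α : unitInterval) {m e : ℕ} (h : History m e) :
    PMF (Choice m (e + 1)) :=
  PMF.ofFintype (fun k => ENNReal.ofReal (attachProb α h (target k))) (by
    rw [← ENNReal.ofReal_sum_of_nonneg fun k _ => attachProb_nonneg α h _, sum_attachProb,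
      ENNReal.ofReal_one])

/-- One step of the attachment process. -/
noncomputable def attachKernel (α : unitInterval) (m e : ℕ) :
    Kernel (History m e) (Choice m (e + 1)) :=
  Kernel.ofFunOfCountable fun h => (attachPMF α h).toMeasure

instance (α : unitInterval) (m e : ℕ) : IsMarkovKernel (attachKernel α m e) :=
  ⟨fun h => inferInstanceAs (IsProbabilityMeasure (attachPMF α h).toMeasure)⟩

/-- The law of the sequence of all targets. The edge number `0` is attached to the vertex `1`, the
only possible choice, and the other edges follow the attachment rule. -/
noncomputable def law (α : unitInterval) (m : ℕ) : Measure (Attachments m) :=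
  Kernel.traj (attachKernel α m) 0 (fun _ => 0)

instance (α : unitInterval) (m : ℕ) : IsProbabilityMeasure (law α m) :=
  inferInstanceAs (IsProbabilityMeasure (Kernel.traj (attachKernel α m) 0 (fun _ => 0)))

/-- The multigraph `G_n`: its vertices are `1, …, n`, and its edges are the edges that are sent by
these vertices. -/
def graph {m : ℕ} (ω : Attachments m) (n : ℕ) : Graph ℕ ℕ where
  vertexSet := Set.Icc 1 n
  IsLink e x y := source m e ≤ n ∧ s(x, y) = s(source m e, target (ω e))
  isLink_symm e _ := ⟨fun x y hxy => ⟨hxy.1, Sym2.eq_swap.trans hxy.2⟩⟩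
  eq_or_eq_of_isLink_of_isLink e x y v w hxy hvw := by
    have := hxy.2.trans hvw.2.symm
    rw [Sym2.eq_iff] at this
    tauto
  left_mem_of_isLink e x y hxy := by
    obtain ⟨hn, hxy⟩ := hxy
    have h2 := (ω e).2
    rw [Sym2.eq_iff] at hxy
    simp only [source, target, Set.mem_Icc] at *
    omega

/-! ### Cycles and multicycles of a multigraph -/

section Multigraph

variable {V E : Type*}

/-- `C` is the edge set of a cycle of length `l` of the multigraph `G`: it consists of `l` distinct
edges that join, in cyclic order, `l` distinct vertices. Two parallel edges form a cycle of
length `2`, and cycles are distinct if they differ in an edge. -/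
def IsCycleOfLength (G : Graph V E) (l : ℕ) (C : Set E) : Prop :=
  1 ≤ l ∧ ∃ (v : ZMod l → V) (e : ZMod l → E), Function.Injective v ∧ Function.Injective e ∧
    (∀ i, G.IsLink (e i) (v i) (v (i + 1))) ∧ C = Set.range e

/-- The set of the cycles of length at most `2r`. -/
def shortCycles (G : Graph V E) (r : ℕ) : Set (Set E) :=
  {C | ∃ l ≤ 2 * r, IsCycleOfLength G l C}

/-- The simple graph in which two distinct vertices are adjacent if some edge of `G` joins them. -/
def simpleGraph (G : Graph V E) : SimpleGraph V where
  Adj x y := x ≠ y ∧ ∃ e, G.IsLink e x y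
  symm := ⟨fun _ _ h => ⟨h.1.symm, h.2.imp fun _ he => he.symm⟩⟩
  loopless := ⟨fun _ h => h.1 rfl⟩

/-- The distance in `G` between two sets of edges: the least length of a path of `G` from an end of
an edge of `C` to an end of an edge of `C'`. -/
noncomputable def cycleDist (G : Graph V E) (C C' : Set E) : ℕ∞ :=
  ⨅ (x : V) (_ : ∃ e ∈ C, G.Inc e x) (y : V) (_ : ∃ e ∈ C', G.Inc e y), (simpleGraph G).edist x y

/-- Two short cycles are linked if some chain of short cycles leads from the first one to the second
one, consecutive ones being at distance at most `r`. -/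
def Linked (G : Graph V E) (r : ℕ) : Set E → Set E → Prop :=
  Relation.ReflTransGen fun A B =>
    A ∈ shortCycles G r ∧ B ∈ shortCycles G r ∧ cycleDist G A B ≤ r

/-- The unions of the classes of linked short cycles. -/
def clusters (G : Graph V E) (r : ℕ) : Set (Set E) :=
  {S | ∃ C ∈ shortCycles G r, S = ⋃₀ {C' | C' ∈ shortCycles G r ∧ Linked G r C C'}}

/-- The short cycles whose distance to every other short cycle exceeds `r`. -/
def isolatedCycles (G : Graph V E) (r : ℕ) : Set (Set E) :=
  {C | C ∈ shortCycles G r ∧ ∀ C' ∈ shortCycles G r, C' ≠ C → (r : ℕ∞) < cycleDist G C C'}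

/-- The multicycles: the clusters that are not isolated cycles, that is, those that consist of at
least two short cycles. -/
def multicycles (G : Graph V E) (r : ℕ) : Set (Set E) :=
  clusters G r \ isolatedCycles G r

end Multigraph

/-- A new multicycle is created when the vertex `n` is attached: some multicycle of `G_n` is not a
multicycle of `G_{n-1}`. -/
def NewMulticycle {m : ℕ} (r : ℕ) (ω : Attachments m) (n : ℕ) : Prop :=
  ∃ S ∈ multicycles (graph ω n) r, S ∉ multicycles (graph ω (n - 1)) r

end PrefAttach

namespace PrefAttach

/-! The proof is a first-moment bound over small dense configurations through the new vertex. If a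
new multicycle appears at step `n`, there are two distinct short cycles at distance at most `r`, and
together with a shortest path between them they form a connected set of at most `5r` edges. It has
`n` as a vertex, all its degrees are at least 2, and some vertex `w` has degree at least 3
(`NewMulticycle.mem_excessEvent`).

Prescribed edges from sources `s` to targets `t` are all present with probability at most a constant
times `∏ s^(-1/2-α/2) t^(-1/2+α/2)` (`law_occurs_le`). The edges are not independent, since every
edge into `t` makes `t` more attractive. A potential built from rising factorials of the vertex
weights absorbs this. Its conditional expectation grows by an explicit factor at each edge, and it
becomes the indicator of the event once all prescribed edges are decided.

For a configuration as above, `∏ (st)^(-1/2) = ∏ v^(-deg v/2) ≤ w^(-1/2) ∏ v⁻¹`. By connectedness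
some path joins `n` to `w`, so the remaining factor `∏ (t/s)^(α/2)` is at most `(w/n)^(α/2)`. As `α
≤ 1`, the power of `w` is absorbed, and `n^(-α/2) ∏ v⁻¹` is left (`IsExcessConfig.le_sum_edgeCost`).
Summed over vertex sets of bounded size containing `n`, this is `O(n^(L-1-α/2))` for every `L` in
`(0, 1]` (`law_excessEvent_le`). The bound tends to zero for `L = 1/2`, and for `α > 0` it is
summable with `L = α/4`. -/

/-! ### One attachment step and its probability -/

/-- Integrating out the target of the edge number `e + 1` with the attachment rule. -/
theorem integral_step (α : unitInterval) (m e : ℕ)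
    (G : Attachments m → Choice m (e + 1) → ℝ)
    (hG : ∀ ω ω' : Attachments m, (∀ j ≤ e, ω j = ω' j) → G ω = G ω') :
    ∫ ω, G ω (ω (e + 1)) ∂law α m =
      ∫ ω, ∑ k, attachProb α (Preorder.frestrictLe e ω : History m e) (target k) * G ω k
        ∂law α m := by
  classical
  -- Histories are padded with the default target; by `hG` the padding does not matter.
  let ext : History m e → Attachments m := fun h j =>
    if hj : j ≤ e then h ⟨j, Finset.mem_Iic.2 hj⟩ else 0
  have hext : ∀ ω : Attachments m, G (ext (Preorder.frestrictLe e ω)) = G ω := by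
    intro ω
    refine hG _ _ fun j hj => ?_
    simp [ext, hj]
  let g : History m e → Choice m (e + 1) → ℝ := fun h => G (ext h)
  have hmap := Kernel.partialTraj_compProd_eq_map_traj (κ := attachKernel α m) (a := 0) (b := e)
    (Nat.zero_le e) (x₀ := fun _ => 0)
  have hgm : Measurable (Function.uncurry g) := measurable_of_countable _
  have hR : (Kernel.traj (attachKernel α m) 0 (fun _ => 0)).map (Preorder.frestrictLe e) =
    Kernel.partialTraj (attachKernel α m) 0 e (fun _ => 0) := Kernel.traj_map_frestrictLe_apply _ _ _
  calc ∫ ω, G ω (ω (e + 1)) ∂law α m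
      = ∫ ω, Function.uncurry g (Preorder.frestrictLe e ω, ω (e + 1)) ∂law α m := by
        refine integral_congr_ae (Filter.Eventually.of_forall fun ω => ?_)
        simp only [Function.uncurry, g, hext]
    _ = ∫ p, Function.uncurry g p
          ∂((law α m).map fun ω => (Preorder.frestrictLe e ω, ω (e + 1))) := by
        rw [integral_map (by fun_prop) hgm.aestronglyMeasurable]
    _ = ∫ h, ∫ k, g h k ∂attachKernel α m e h
          ∂(Kernel.partialTraj (attachKernel α m) 0 e (fun _ => 0)) := by
        rw [law, ← hmap, Measure.integral_compProd]
        · rfl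
        · exact Integrable.of_finite
    _ = ∫ h, ∑ k, attachProb α h (target k) * g h k
          ∂(Kernel.partialTraj (attachKernel α m) 0 e (fun _ => 0)) := by
        refine integral_congr_ae (Filter.Eventually.of_forall fun h => ?_)
        change ∫ k, g h k ∂(attachPMF α h).toMeasure = _
        rw [PMF.integral_eq_sum]
        refine Finset.sum_congr rfl fun k _ => ?_
        rw [smul_eq_mul]
        congr 1
        exact ENNReal.toReal_ofReal (attachProb_nonneg α h _)
    _ = _ := by
        rw [← hR, integral_map (by fun_prop) (measurable_of_countable _).aestronglyMeasurable]
        refine integral_congr_ae (Filter.Eventually.of_forall fun ω => ?_)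
        simp only [g, hext]

/-- The number of edges among the edges `0, …, e` that are attached to the vertex `t`. -/
def hits {m : ℕ} (ω : Attachments m) (e t : ℕ) : ℕ :=
  ∑ j ∈ Finset.Iic e, if target (ω j) = t then 1 else 0

theorem hits_succ {m : ℕ} (ω : Attachments m) (e t : ℕ) :
    hits ω (e + 1) t = hits ω e t + if target (ω (e + 1)) = t then 1 else 0 := by
  have hI : ∀ k : ℕ, Finset.Iic k = Finset.range (k + 1) := fun k => by
    ext; simp
  simp only [hits, hI]
  rw [Finset.sum_range_succ]

/-- The edges sent by `t` have numbers in an interval of length `m`. -/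
theorem degree_le_hits {m : ℕ} (hm : 1 ≤ m) (ω : Attachments m) (e t : ℕ) :
    degree (Preorder.frestrictLe e ω : History m e) t ≤ m + hits ω e t := by
  have h : degree (Preorder.frestrictLe e ω : History m e) t
      = ∑ j ∈ Finset.Iic e, ((if source m j = t then 1 else 0) +
        (if target (ω j) = t then 1 else 0)) :=
    Finset.sum_coe_sort (Finset.Iic e) fun j => ((if source m j = t then 1 else 0) +
        (if target (ω j) = t then 1 else 0))
  rw [h, Finset.sum_add_distrib]
  refine Nat.add_le_add_right ?_ _
  rw [Finset.sum_ite, Finset.sum_const_zero, add_zero, ← Finset.card_eq_sum_ones]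
  calc _ ≤ (Finset.Ico (m * (t - 2)) (m * (t - 2) + m)).card := by
        refine Finset.card_le_card fun j hj => ?_
        obtain ⟨-, hj⟩ := Finset.mem_filter.1 hj
        have hj' : j / m = t - 2 := by rw [← hj]; rfl
        have h1 := Nat.div_add_mod j m
        have h2 := Nat.mod_lt j hm
        rw [hj'] at h1
        rw [Finset.mem_Ico]
        omega
    _ = m := by simp

/-- An upper bound for the reciprocal of the total attachment weight at the edge number `e`. -/
noncomputable def rate (m e : ℕ) : ℝ := if e < m then 1 else 1 / (2 * (m * (e / m : ℕ)))

theorem rate_nonneg (m e : ℕ) : 0 ≤ rate m e := by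
  unfold rate; split_ifs <;> positivity

/-- The weight of the vertex `t`, which bounds the numerator of its attachment probability. -/
noncomputable def weight {m : ℕ} (β : ℝ) (ω : Attachments m) (e t : ℕ) : ℝ :=
  β * hits ω e t + 2 * m

/-- The coefficient `α_n(i)` is designed so that the two rules merge into a single fraction, `((1 -
α) deg + 2mα) / D`, linear in the degree. Bounding the degree by `m + hits` turns the numerator into
the weight, and `1 / D` is at most `rate`. -/
theorem attachProb_le (α : unitInterval) {m : ℕ} (hm : 1 ≤ m) (ω : Attachments m) (e t : ℕ) :
    attachProb α (Preorder.frestrictLe e ω : History m e) t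
      ≤ weight (1 - α) ω e t * rate m (e + 1) := by
  obtain ⟨a, ha0, ha1⟩ := α
  have hdeg : (degree (Preorder.frestrictLe e ω : History m e) t : ℝ) ≤ m + hits ω e t := by
    exact_mod_cast degree_le_hits hm ω e t
  have hd0 : (0 : ℝ) ≤ (degree (Preorder.frestrictLe e ω : History m e) t : ℝ) := by positivity
  simp only [attachProb, uniformCoeff, source, weight]
  set d : ℝ := (degree (Preorder.frestrictLe e ω : History m e) t : ℝ)
  set H : ℝ := (hits ω e t : ℝ)
  have hdm := Nat.div_add_mod (e + 1) m
  have hlt := Nat.mod_lt (e + 1) hm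
  set q := (e + 1) / m
  set ρ := (e + 1) % m
  have hm' : (1 : ℝ) ≤ m := by exact_mod_cast hm
  have hρm : (ρ : ℝ) ≤ m := by exact_mod_cast hlt.le
  have hq0 : (0 : ℝ) ≤ q := by positivity
  have hρ0 : (0 : ℝ) ≤ ρ := by positivity
  have hE : (1 : ℝ) ≤ m * q + ρ := by
    have : 1 ≤ m * q + ρ := by omega
    exact_mod_cast this
  have hmq : 0 ≤ (m : ℝ) * q := by positivity
  set D : ℝ := 2 * m * q + ρ + a * (2 * m - ρ) with hD
  have haD : 0 ≤ a * (2 * m - ρ) := mul_nonneg ha0 (by linarith)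
  have hDpos : 0 < D := by rw [hD]; nlinarith
  have hS : 0 < 2 * (m : ℝ) * q + ρ := by nlinarith
  have key : a * (2 * m * (((q + 2 : ℕ) : ℝ) - 1)) /
      (2 * m * (((q + 2 : ℕ) : ℝ) - 2) + 2 * m * a + (1 - a) * (((ρ + 1 : ℕ) : ℝ) - 1)) *
      (1 / (((q + 2 : ℕ) : ℝ) - 1)) +
      (1 - a * (2 * m * (((q + 2 : ℕ) : ℝ) - 1)) /
      (2 * m * (((q + 2 : ℕ) : ℝ) - 2) + 2 * m * a + (1 - a) * (((ρ + 1 : ℕ) : ℝ) - 1))) *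
      (d / (2 * m * (((q + 2 : ℕ) : ℝ) - 2) + (((ρ + 1 : ℕ) : ℝ) - 1)))
      = ((1 - a) * d + 2 * m * a) / D := by
    push_cast
    have e1 : 2 * (m : ℝ) * ((q : ℝ) + 2 - 2) + 2 * m * a + (1 - a) * ((ρ : ℝ) + 1 - 1) = D := by
      rw [hD]; ring
    have e2 : 2 * (m : ℝ) * ((q : ℝ) + 2 - 2) + ((ρ : ℝ) + 1 - 1) = 2 * m * q + ρ := by ring
    have e3 : (q : ℝ) + 2 - 1 = q + 1 := by ring
    rw [e1, e2, e3]
    have hq1 : (q : ℝ) + 1 ≠ 0 := by positivity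
    have hS' := hS.ne'
    have hD' := hDpos.ne'
    have e4 : 1 - a * (2 * m * ((q : ℝ) + 1)) / D = (1 - a) * (2 * m * q + ρ) / D := by
      field_simp
      rw [hD]; ring
    rw [e4]
    field_simp
    ring
  rw [key]
  have hnum : (1 - a) * d + 2 * m * a ≤ (1 - a) * H + 2 * m := by
    nlinarith [mul_le_mul_of_nonneg_left hdeg (by linarith : 0 ≤ 1 - a)]
  have hnum0 : 0 ≤ (1 - a) * H + 2 * m := by
    have : 0 ≤ (1 - a) * d := mul_nonneg (by linarith) hd0
    nlinarith
  have hrate : 1 / D ≤ rate m (e + 1) := by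
    unfold rate
    split_ifs with hlt'
    · rw [div_le_one hDpos]; nlinarith
    · have hq1 : 1 ≤ q := (Nat.one_le_div_iff hm).2 (by omega)
      have hq1' : (1 : ℝ) ≤ q := by exact_mod_cast hq1
      apply one_div_le_one_div_of_le
      · positivity
      · rw [hD]; simp only [q] at *; nlinarith
  calc _ = ((1 - a) * d + 2 * m * a) * (1 / D) := by ring
    _ ≤ ((1 - a) * H + 2 * m) * (1 / D) := by gcongr
    _ ≤ _ := by gcongr

/-! ### Rising factorials and the potential -/

/-- Rising factorials with step `β`. -/
def rise (β x : ℝ) (a : ℕ) : ℝ := ∏ i ∈ Finset.range a, (x + β * i)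

theorem rise_pos {β x : ℝ} (hβ : 0 ≤ β) (hx : 0 < x) (a : ℕ) : 0 < rise β x a :=
  Finset.prod_pos fun _ _ => by positivity

theorem rise_succ (β x : ℝ) (a : ℕ) : rise β x (a + 1) = x * rise β (x + β) a := by
  simp only [rise]
  rw [Finset.prod_range_succ']
  simp only [Nat.cast_zero, mul_zero, add_zero, Nat.cast_add, Nat.cast_one]
  rw [mul_comm]
  congr 1
  refine Finset.prod_congr rfl fun i _ => by ring

theorem mul_rise_add (β x : ℝ) (a : ℕ) : x * rise β (x + β) a = rise β x a * (x + β * a) := by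
  rw [← rise_succ, rise, Finset.prod_range_succ, rise]

theorem rise_le {β x : ℝ} (hβ0 : 0 ≤ β) (hβ1 : β ≤ 1) (hx : 0 ≤ x) {a K : ℕ} (ha : a ≤ K) :
    rise β x a ≤ (x + K) ^ a := by
  calc rise β x a ≤ ∏ i ∈ Finset.range a, (x + K) := by
        refine Finset.prod_le_prod (fun _ _ => by positivity) fun i hi => ?_
        have : (i : ℝ) ≤ K := by exact_mod_cast (Finset.mem_range.1 hi).le.trans ha
        nlinarith [(Nat.cast_nonneg i : (0 : ℝ) ≤ i)]
    _ = _ := by simp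

/-- An edge into `v` changes only the factor of `v`. Both `w * rise β (w + β) a` and `rise β w a *
(w + β * a)` equal `rise β w (a + 1)`, so the change is the factor `1 + β * a / w`. -/
theorem prod_rise_shift {β : ℝ} (T : Finset ℕ) (w : ℕ → ℝ) (hw : ∀ t, 0 < w t) (a : ℕ → ℕ)
    (v : ℕ) :
    ∏ t ∈ T, rise β (w t + if v = t then β else 0) (a t) =
      (∏ t ∈ T, rise β (w t) (a t)) * (1 + ∑ t ∈ T, if v = t then β * a t / w t else 0) := by
  rw [Finset.sum_ite_eq]
  by_cases hv : v ∈ T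
  · rw [if_pos hv, ← Finset.mul_prod_erase T _ hv, ← Finset.mul_prod_erase T (fun t => rise β (w t) _) hv,
      if_pos rfl]
    have h1 : ∏ t ∈ T.erase v, rise β (w t + if v = t then β else 0) (a t)
        = ∏ t ∈ T.erase v, rise β (w t) (a t) := by
      refine Finset.prod_congr rfl fun t ht => ?_
      rw [if_neg (Finset.ne_of_mem_erase ht).symm, add_zero]
    have h2 : rise β (w v + β) (a v) = rise β (w v) (a v) * (1 + β * a v / w v) := by
      have := mul_rise_add β (w v) (a v)
      have hv0 := (hw v).ne'
      field_simp
      linarith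
    rw [h1, h2]
    ring
  · rw [if_neg hv, add_zero, mul_one]
    refine Finset.prod_congr rfl fun t ht => ?_
    rw [if_neg (fun h : v = t => hv (h ▸ ht)), add_zero]

/-- The number of edges in `F` that come after the edge number `e` and end in `t`. -/
def pending (F : Finset (ℕ × ℕ)) (e t : ℕ) : ℕ := (F.filter fun p => p.2 = t ∧ e < p.1).card

/-- The potential that dominates the conditional probability that all edges in `F` occur. -/
noncomputable def potential {m : ℕ} (β : ℝ) (F : Finset (ℕ × ℕ)) (e : ℕ) (ω : Attachments m) : ℝ :=
  open Classical in
  if ∀ p ∈ F, p.1 ≤ e → target (ω p.1) = p.2 then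
    ∏ t ∈ F.image Prod.snd, rise β (weight β ω e t) (pending F e t) else 0

/-- The contribution of the pair `p` to the growth of the potential at the edge number `e`. -/
noncomputable def stepFactor (β : ℝ) (m e : ℕ) (p : ℕ × ℕ) : ℝ :=
  if p.1 = e then rate m e else if e < p.1 ∧ p.2 < source m e then Real.exp (β * rate m e) else 1

theorem stepFactor_nonneg (β : ℝ) (m e : ℕ) (p : ℕ × ℕ) : 0 ≤ stepFactor β m e p := by
  unfold stepFactor
  split_ifs
  · exact rate_nonneg m e
  · positivity
  · exact zero_le_one

theorem weight_pos {m : ℕ} (hm : 1 ≤ m) {β : ℝ} (hβ : 0 ≤ β) (ω : Attachments m) (e t : ℕ) :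
    0 < weight β ω e t := by
  have : (1 : ℝ) ≤ m := by exact_mod_cast hm
  unfold weight
  positivity

theorem hits_congr {m : ℕ} {ω ω' : Attachments m} {e : ℕ} (h : ∀ j ≤ e, ω j = ω' j) (t : ℕ) :
    hits ω e t = hits ω' e t :=
  Finset.sum_congr rfl fun j hj => by rw [h j (Finset.mem_Iic.1 hj)]

theorem potential_congr {m : ℕ} {β : ℝ} {F : Finset (ℕ × ℕ)} {ω ω' : Attachments m} {e : ℕ}
    (h : ∀ j ≤ e, ω j = ω' j) : potential β F e ω = potential β F e ω' := by
  unfold potential weight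
  simp only [hits_congr h]
  congr 1
  refine propext (forall₂_congr fun p _ => forall_congr' fun hp => ?_)
  rw [h _ hp]

/-- Such a function factors through the finite space of histories up to `e`. -/
theorem integrable_of_congr (α : unitInterval) {m e : ℕ} {f : Attachments m → ℝ}
    (hf : ∀ ω ω' : Attachments m, (∀ j ≤ e, ω j = ω' j) → f ω = f ω') :
    Integrable f (law α m) := by
  classical
  let ext : History m e → Attachments m := fun h j =>
    if hj : j ≤ e then h ⟨j, Finset.mem_Iic.2 hj⟩ else 0
  have h : f = (fun h => f (ext h)) ∘ (Preorder.frestrictLe e) := by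
    funext ω
    refine hf _ _ fun j hj => ?_
    simp [ext, hj]
  rw [h]
  exact (Integrable.of_finite (μ := (law α m).map (Preorder.frestrictLe e))).comp_measurable
    (by fun_prop)

theorem target_injective {m e : ℕ} : Function.Injective (target : Choice m e → ℕ) :=
  fun a b h => Fin.ext (by simpa [target] using h)

theorem target_lt_source {m e : ℕ} (k : Choice m e) : target k < source m e := by
  have := k.2
  simp only [target, source]
  omega

theorem sum_target_eq {m e : ℕ} (f : ℕ → ℝ) (c : ℝ) (t : ℕ) (hc : 0 ≤ c)
    (hf : t < source m e → f t ≤ c) :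
    ∑ k : Choice m e, (if target k = t then f (target k) else 0) ≤ if t < source m e then c else 0 := by
  by_cases h : ∃ k : Choice m e, target k = t
  · obtain ⟨k, rfl⟩ := h
    rw [if_pos (target_lt_source k), Finset.sum_eq_single k, if_pos rfl]
    · exact hf (target_lt_source k)
    · exact fun b _ hb => if_neg fun h => hb (target_injective h)
    · exact fun h => absurd (Finset.mem_univ _) h
  · push Not at h
    rw [Finset.sum_eq_zero fun k _ => if_neg (h k)]
    split_ifs
    · exact hc
    · exact le_rfl

theorem pending_succ_of_forall_ne {F : Finset (ℕ × ℕ)} {e : ℕ} (h : ∀ p ∈ F, p.1 ≠ e + 1) (t : ℕ) :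
    pending F (e + 1) t = pending F e t := by
  unfold pending
  congr 1
  refine Finset.filter_congr fun p hp => ?_
  have := h p hp
  omega

theorem pending_eq_succ {F : Finset (ℕ × ℕ)} (hF : Set.InjOn Prod.fst (F : Set (ℕ × ℕ)))
    {p : ℕ × ℕ} (hp : p ∈ F) {e : ℕ} (he : p.1 = e + 1) (t : ℕ) :
    pending F e t = pending F (e + 1) t + if p.2 = t then 1 else 0 := by
  classical
  unfold pending
  split_ifs with h
  · rw [← Finset.card_insert_of_notMem (a := p) (by simp [he])]
    congr 1
    ext p'
    simp only [Finset.mem_filter, Finset.mem_insert]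
    constructor
    · rintro ⟨h1, h2, h3⟩
      by_cases h4 : p'.1 = e + 1
      · exact Or.inl (hF h1 hp (h4.trans he.symm))
      · exact Or.inr ⟨h1, h2, by omega⟩
    · rintro (rfl | ⟨h1, h2, h3⟩)
      · exact ⟨hp, h, by omega⟩
      · exact ⟨h1, h2, by omega⟩
  · rw [add_zero]
    congr 1
    refine Finset.filter_congr fun p' hp' => ?_
    by_cases h4 : p'.1 = e + 1
    · have := hF hp' hp (h4.trans he.symm)
      subst this
      simp [h]
    · omega

/-- Grouping by target; this distributes the growth of the potential over the individual pending
edges. -/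
theorem sum_pending (F : Finset (ℕ × ℕ)) (e s : ℕ) :
    ∑ t ∈ F.image Prod.snd, (if t < s then pending F e t else 0) =
      (F.filter fun p => e < p.1 ∧ p.2 < s).card := by
  classical
  rw [Finset.card_eq_sum_card_fiberwise (f := Prod.snd) (t := F.image Prod.snd)]
  · refine Finset.sum_congr rfl fun t _ => ?_
    split_ifs with h
    · unfold pending
      congr 1
      ext p
      simp only [Finset.mem_filter]
      constructor
      · rintro ⟨h1, h2, h3⟩
        exact ⟨⟨h1, h3, by omega⟩, h2⟩
      · rintro ⟨⟨h1, h2, h3⟩, h4⟩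
        exact ⟨h1, h4, h2⟩
    · symm
      rw [Finset.card_eq_zero, Finset.filter_eq_empty_iff]
      intro p hp hpt
      have := (Finset.mem_filter.1 hp).2.2
      omega
  · intro p hp
    exact Finset.mem_coe.2 (Finset.mem_image_of_mem _ (Finset.mem_filter.1 hp).1)

theorem weight_succ {m : ℕ} (β : ℝ) (ω : Attachments m) (e t : ℕ) :
    weight β ω (e + 1) t = weight β ω e t + if target (ω (e + 1)) = t then β else 0 := by
  unfold weight
  rw [hits_succ]
  split_ifs <;> push_cast <;> ring

/-- The value of the potential at the edge number `e + 1` if this edge makes the choice `k`. -/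
noncomputable def nextPotential {m : ℕ} (β : ℝ) (F : Finset (ℕ × ℕ)) (e : ℕ) (ω : Attachments m)
    (k : Choice m (e + 1)) : ℝ :=
  open Classical in
  if (∀ p ∈ F, p.1 ≤ e → target (ω p.1) = p.2) ∧ ∀ p ∈ F, p.1 = e + 1 → target k = p.2 then
    ∏ t ∈ F.image Prod.snd,
      rise β (weight β ω e t + if target k = t then β else 0) (pending F (e + 1) t) else 0

theorem potential_succ {m : ℕ} (β : ℝ) (F : Finset (ℕ × ℕ)) (e : ℕ) (ω : Attachments m) :
    potential β F (e + 1) ω = nextPotential β F e ω (ω (e + 1)) := by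
  unfold potential nextPotential
  simp only [weight_succ]
  congr 1
  refine propext ⟨fun h => ⟨fun p hp hpe => h p hp (by omega), ?_⟩, ?_⟩
  · rintro ⟨i, t⟩ hp rfl
    exact h _ hp le_rfl
  · rintro ⟨h1, h2⟩ ⟨i, t⟩ hp hpe
    rcases Nat.le_succ_iff.1 hpe with h | h
    · exact h1 _ hp h
    · simp only at h
      subst h
      exact h2 _ hp rfl

/-- Let a target `t` have weight `w` and `a` pending edges. If the edge `e + 1` is prescribed to end
in `t`, this has probability at most `w * rate`, and `w * rise β (w + β) (a - 1) = rise β w a`: the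
step costs one `rate`. If it is not prescribed, a hit on `t` multiplies the potential by `1 + β * a
/ w`, again with probability at most `w * rate`. The weight cancels, and the expected growth is at
most `1 + β * rate * ∑ a`, hence at most an exponential that splits into one factor per pending
edge. Only vertices older than the current source can be hit. -/
theorem sum_attachProb_mul_nextPotential_le (α : unitInterval) {m : ℕ} (hm : 1 ≤ m)
    {F : Finset (ℕ × ℕ)} (hF : Set.InjOn Prod.fst (F : Set (ℕ × ℕ)))
    (e : ℕ) (ω : Attachments m) :
    ∑ k, attachProb α (Preorder.frestrictLe e ω : History m e) (target k) *
        nextPotential (1 - α) F e ω k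
      ≤ potential (1 - α) F e ω * ∏ p ∈ F, stepFactor (1 - α) m (e + 1) p := by
  classical
  set β : ℝ := 1 - α with hβdef
  have hβ : 0 ≤ β := sub_nonneg.2 α.2.2
  have hw := weight_pos hm hβ ω e
  have hη := rate_nonneg m (e + 1)
  have hP : ∀ t, attachProb α (Preorder.frestrictLe e ω : History m e) t
      ≤ weight β ω e t * rate m (e + 1) := attachProb_le α hm ω e
  by_cases hA : ∀ p ∈ F, p.1 ≤ e → target (ω p.1) = p.2
  swap
  · have h0 : ∀ k, nextPotential β F e ω k = 0 := fun k => if_neg fun h => hA h.1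
    have h1 : potential β F e ω = 0 := if_neg hA
    simp [h0, h1]
  have hpot : potential β F e ω
      = ∏ t ∈ F.image Prod.snd, rise β (weight β ω e t) (pending F e t) := if_pos hA
  have hpot0 : 0 ≤ potential β F e ω := by
    rw [hpot]; exact Finset.prod_nonneg fun t _ => (rise_pos hβ (hw t) _).le
  by_cases hp : ∃ p ∈ F, p.1 = e + 1
  · obtain ⟨p, hpF, hpe⟩ := hp
    have hfac : rate m (e + 1) ≤ ∏ p ∈ F, stepFactor β m (e + 1) p := by
      rw [← Finset.mul_prod_erase F _ hpF]
      have h1 : stepFactor β m (e + 1) p = rate m (e + 1) := if_pos hpe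
      rw [h1]
      -- By injectivity no other pair has the number `e + 1`, so the other factors are exponentials
      -- or 1 and can only enlarge the bound.
      refine le_mul_of_one_le_right hη (Finset.one_le_prod fun p' hp' => ?_)
      have hne : p'.1 ≠ e + 1 := fun h => Finset.ne_of_mem_erase hp'
        (hF (Finset.mem_of_mem_erase hp') hpF (h.trans hpe.symm))
      unfold stepFactor
      rw [if_neg hne]
      split_ifs
      · exact Real.one_le_exp (mul_nonneg hβ hη)
      · exact le_rfl
    refine le_trans ?_ (mul_le_mul_of_nonneg_left hfac hpot0)
    have hnext : ∀ k, nextPotential β F e ω k = if target k = p.2 then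
        ∏ t ∈ F.image Prod.snd,
          rise β (weight β ω e t + if p.2 = t then β else 0) (pending F (e + 1) t) else 0 := by
      intro k
      unfold nextPotential
      by_cases hk : target k = p.2
      · rw [if_pos hk, if_pos, hk]
        refine ⟨hA, fun p' hp' he' => ?_⟩
        rw [hF hp' hpF (he'.trans hpe.symm), hk]
      · rw [if_neg hk, if_neg]
        exact fun h => hk (h.2 p hpF hpe)
    have hmem : p.2 ∈ F.image Prod.snd := Finset.mem_image_of_mem _ hpF
    have hprod : weight β ω e p.2 * ∏ t ∈ F.image Prod.snd,
          rise β (weight β ω e t + if p.2 = t then β else 0) (pending F (e + 1) t)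
        = potential β F e ω := by
      rw [hpot, ← Finset.mul_prod_erase _ _ hmem, ← Finset.mul_prod_erase _ (fun t =>
        rise β (weight β ω e t) (pending F e t)) hmem, pending_eq_succ hF hpF hpe, if_pos rfl,
        if_pos rfl, rise_succ, mul_assoc]
      congr 2
      refine Finset.prod_congr rfl fun t ht => ?_
      have hne := (Finset.ne_of_mem_erase ht).symm
      rw [pending_eq_succ hF hpF hpe, if_neg hne, if_neg hne, add_zero, add_zero]
    set R := ∏ t ∈ F.image Prod.snd,
          rise β (weight β ω e t + if p.2 = t then β else 0) (pending F (e + 1) t) with hR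
    have hR0 : 0 ≤ R := Finset.prod_nonneg fun t _ => (rise_pos hβ (by
      have := hw t
      split_ifs <;> linarith) _).le
    simp only [hnext, mul_ite, mul_zero]
    refine (sum_target_eq (fun t => attachProb α (Preorder.frestrictLe e ω : History m e) t * R)
      (potential β F e ω * rate m (e + 1)) p.2 (mul_nonneg hpot0 hη) fun _ => ?_).trans ?_
    · rw [← hprod]
      calc _ ≤ (weight β ω e p.2 * rate m (e + 1)) * R := mul_le_mul_of_nonneg_right (hP _) hR0
        _ = _ := by ring
    · split_ifs
      · exact le_rfl
      · exact mul_nonneg hpot0 hη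
  · push Not at hp
    have hfac : ∏ p ∈ F, stepFactor β m (e + 1) p =
        Real.exp (β * rate m (e + 1) *
          ((F.filter fun p => e < p.1 ∧ p.2 < source m (e + 1)).card : ℝ)) := by
      rw [mul_comm, ← nsmul_eq_mul, Real.exp_nsmul, ← Finset.prod_const, Finset.prod_filter]
      refine Finset.prod_congr rfl fun p hpF => ?_
      unfold stepFactor
      rw [if_neg (hp p hpF)]
      refine if_congr ?_ rfl rfl
      have := hp p hpF
      omega
    have hnext : ∀ k, nextPotential β F e ω k = potential β F e ω *
        (1 + ∑ t ∈ F.image Prod.snd,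
          if target k = t then β * pending F e t / weight β ω e t else 0) := by
      intro k
      unfold nextPotential
      rw [if_pos ⟨hA, fun p hpF h => absurd h (hp p hpF)⟩, hpot, ← prod_rise_shift _ _ hw]
      simp only [pending_succ_of_forall_ne hp]
    rw [hfac]
    simp only [hnext]
    calc _ = potential β F e ω * (∑ k : Choice m (e + 1),
            attachProb α (Preorder.frestrictLe e ω : History m e) (target k) +
          ∑ t ∈ F.image Prod.snd, ∑ k : Choice m (e + 1), if target k = t then
            attachProb α (Preorder.frestrictLe e ω : History m e) (target k) *
              (β * pending F e t / weight β ω e t) else 0) := by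
          rw [Finset.sum_comm, ← Finset.sum_add_distrib, Finset.mul_sum]
          refine Finset.sum_congr rfl fun k _ => ?_
          rw [mul_left_comm, mul_add, mul_one, Finset.mul_sum]
          simp only [mul_ite, mul_zero]
      _ ≤ potential β F e ω * (1 + ∑ t ∈ F.image Prod.snd,
            if t < source m (e + 1) then β * rate m (e + 1) * pending F e t else 0) := by
          rw [sum_attachProb]
          refine mul_le_mul_of_nonneg_left (add_le_add le_rfl (Finset.sum_le_sum fun t _ => ?_)) hpot0
          refine sum_target_eq (fun s => attachProb α (Preorder.frestrictLe e ω : History m e) s *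
              (β * pending F e t / weight β ω e t)) _ t (by positivity) fun _ => ?_
          have hwt := (hw t).ne'
          calc _ ≤ weight β ω e t * rate m (e + 1) * (β * pending F e t / weight β ω e t) :=
                mul_le_mul_of_nonneg_right (hP t) (by have := hw t; positivity)
            _ = _ := by field_simp
      _ = potential β F e ω * (β * rate m (e + 1) *
            ((F.filter fun p => e < p.1 ∧ p.2 < source m (e + 1)).card : ℝ) + 1) := by
          rw [← sum_pending, Nat.cast_sum, Finset.mul_sum, add_comm]
          congr 2
          refine Finset.sum_congr rfl fun t _ => ?_
          split_ifs <;> simp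
      _ ≤ _ := mul_le_mul_of_nonneg_left (Real.add_one_le_exp _) hpot0

theorem integral_potential_succ_le (α : unitInterval) {m : ℕ} (hm : 1 ≤ m)
    {F : Finset (ℕ × ℕ)} (hF : Set.InjOn Prod.fst (F : Set (ℕ × ℕ))) (e : ℕ) :
    ∫ ω, potential (1 - α) F (e + 1) ω ∂law α m ≤
      (∫ ω, potential (1 - α) F e ω ∂law α m) * ∏ p ∈ F, stepFactor (1 - α) m (e + 1) p := by
  have hcongr : ∀ ω ω' : Attachments m, (∀ j ≤ e, ω j = ω' j) →
      nextPotential (1 - (α : ℝ)) F e ω = nextPotential (1 - (α : ℝ)) F e ω' := by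
    intro ω ω' h
    funext k
    unfold nextPotential weight
    simp only [hits_congr h]
    congr 2
    refine propext (forall₂_congr fun p _ => forall_congr' fun hp => ?_)
    rw [h _ hp]
  simp only [potential_succ]
  rw [integral_step α m e _ hcongr, ← integral_mul_const]
  refine integral_mono ?_ ?_ fun ω => sum_attachProb_mul_nextPotential_le α hm hF e ω
  · refine integrable_of_congr (e := e) α fun ω ω' h => ?_
    have h2 : (Preorder.frestrictLe e ω : History m e) = Preorder.frestrictLe e ω' := by
      funext j
      exact h j (Finset.mem_Iic.1 j.2)
    rw [h2, hcongr ω ω' h]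
  · exact (integrable_of_congr (e := e) α fun ω ω' h => potential_congr h).mul_const _

/-- Only the edge number `0` has been counted, so every weight is at most `2m + 1`, and the rising
factorials have at most `F.card` factors altogether. -/
theorem potential_zero_le {α : unitInterval} {m : ℕ} (hm : 1 ≤ m) (F : Finset (ℕ × ℕ))
    (ω : Attachments m) :
    potential (1 - α) F 0 ω ≤ (2 * m + 1 + F.card : ℝ) ^ F.card := by
  classical
  have hβ : (0 : ℝ) ≤ 1 - α := sub_nonneg.2 α.2.2
  have hβ1 : (1 : ℝ) - α ≤ 1 := by linarith [α.2.1]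
  unfold potential
  split_ifs
  swap
  · positivity
  have hsum : ∑ t ∈ F.image Prod.snd, pending F 0 t ≤ F.card := by
    rw [Finset.card_eq_sum_card_fiberwise (f := Prod.snd) (t := F.image Prod.snd)
      fun p hp => Finset.mem_coe.2 (Finset.mem_image_of_mem _ hp)]
    refine Finset.sum_le_sum fun t _ => Finset.card_le_card fun p hp => ?_
    simp only [Finset.mem_filter] at hp ⊢
    exact ⟨hp.1, hp.2.1⟩
  have hone : (1 : ℝ) ≤ 2 * m + 1 + F.card := by
    have : (0 : ℝ) ≤ 2 * m + F.card := by positivity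
    linarith
  calc _ ≤ ∏ t ∈ F.image Prod.snd, (2 * m + 1 + F.card : ℝ) ^ pending F 0 t := by
        refine Finset.prod_le_prod (fun t _ => (rise_pos hβ (weight_pos hm hβ _ _ _) _).le)
          fun t _ => ?_
        have hw := weight_pos hm hβ ω 0 t
        refine (rise_le hβ hβ1 hw.le (Finset.card_filter_le F _)).trans ?_
        refine pow_le_pow_left₀ (by positivity) ?_ _
        have : (hits ω 0 t : ℝ) ≤ 1 := by
          have : hits ω 0 t ≤ 1 := by
            have hI : Finset.Iic 0 = {0} := rfl
            unfold hits
            rw [hI, Finset.sum_singleton]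
            split_ifs <;> simp
          exact_mod_cast this
        unfold weight
        nlinarith [(Nat.cast_nonneg (hits ω 0 t) : (0 : ℝ) ≤ hits ω 0 t)]
    _ = (2 * m + 1 + F.card : ℝ) ^ ∑ t ∈ F.image Prod.snd, pending F 0 t :=
        Finset.prod_pow_eq_pow_sum _ _ _
    _ ≤ _ := pow_le_pow_right₀ hone hsum

theorem integral_potential_le (α : unitInterval) {m : ℕ} (hm : 1 ≤ m)
    {F : Finset (ℕ × ℕ)} (hF : Set.InjOn Prod.fst (F : Set (ℕ × ℕ))) (e : ℕ) :
    ∫ ω, potential (1 - α) F e ω ∂law α m ≤ (2 * m + 1 + F.card : ℝ) ^ F.card *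
      ∏ p ∈ F, ∏ i ∈ Finset.range e, stepFactor (1 - α) m (i + 1) p := by
  induction e with
  | zero =>
    simp only [Finset.range_zero, Finset.prod_empty, Finset.prod_const_one, mul_one]
    refine (integral_mono (integrable_of_congr (e := 0) α fun ω ω' h => potential_congr h)
      (integrable_const _) (potential_zero_le hm F)).trans ?_
    simp
  | succ e ih =>
    refine (integral_potential_succ_le α hm hF e).trans ?_
    simp only [Finset.prod_range_succ, Finset.prod_mul_distrib]
    rw [← mul_assoc]
    exact mul_le_mul_of_nonneg_right ih (Finset.prod_nonneg fun p _ => stepFactor_nonneg _ _ _ _)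

/-! ### Probability that prescribed edges are present -/

/-- The event that the edges in `F`, given by their numbers and targets, are present. -/
def occurs (m : ℕ) (F : Finset (ℕ × ℕ)) : Set (Attachments m) :=
  {ω | ∀ p ∈ F, target (ω p.1) = p.2}

/-- When `e` has passed all edges of `F`, nothing is pending, all rising factorials are empty, and
the potential is the indicator of the event. -/
theorem law_occurs_le_prod (α : unitInterval) {m : ℕ} (hm : 1 ≤ m)
    {F : Finset (ℕ × ℕ)} (hF : Set.InjOn Prod.fst (F : Set (ℕ × ℕ))) {e : ℕ}
    (he : ∀ p ∈ F, p.1 ≤ e) :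
    (law α m).real (occurs m F) ≤ (2 * m + 1 + F.card : ℝ) ^ F.card *
      ∏ p ∈ F, ∏ i ∈ Finset.range e, stepFactor (1 - α) m (i + 1) p := by
  classical
  have hmeas : MeasurableSet (occurs m F) := by
    have : occurs m F = ⋂ p ∈ F, (fun ω : Attachments m => ω p.1) ⁻¹' {k | target k = p.2} := by
      ext ω; simp [occurs]
    rw [this]
    exact Finset.measurableSet_biInter _ fun p _ =>
      (measurable_pi_apply _) (Set.toFinite _).measurableSet
  rw [← integral_indicator_one hmeas]
  refine le_trans (le_of_eq ?_) (integral_potential_le α hm hF e)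
  congr 1
  funext ω
  have hpend : ∀ t, pending F e t = 0 := fun t => by
    unfold pending
    rw [Finset.card_eq_zero, Finset.filter_eq_empty_iff]
    intro p hp h
    have := he p hp
    omega
  have hiff : (∀ p ∈ F, p.1 ≤ e → target (ω p.1) = p.2) ↔ ω ∈ occurs m F :=
    forall₂_congr fun p hp => by simp [he p hp]
  unfold potential
  by_cases hω : ω ∈ occurs m F
  · rw [if_pos (hiff.2 hω), Set.indicator_of_mem hω]
    simp [hpend, rise]
  · rw [if_neg fun h => hω (hiff.1 h), Set.indicator_of_notMem hω]

theorem source_le_iff {m : ℕ} (hm : 1 ≤ m) (e Q : ℕ) : source m e ≤ Q + 1 ↔ e < m * Q := by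
  unfold source
  rw [mul_comm, ← Nat.div_lt_iff_lt_mul hm]
  omega

/-- The `m` edges of the vertex `q + 2` with `q ≥ 1` contribute `1 / (2q)` together, so the sum is
half a harmonic sum, hence half a logarithm; the edges of the vertex 2 account for the `m`. The
logarithm supplies `1 / (Q + 3)` where the block needs `1 / (Q + 1)`, and the telescoping slack `2 -
2 / (Q + 1)` pays for the difference. -/
theorem sum_rate_block {m : ℕ} (hm : 1 ≤ m) (t Q : ℕ) (htQ : t ≤ Q + 2) :
    ∑ i ∈ Finset.range (m * (Q + 1)), (if t < source m i then rate m i else 0) ≤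
      m + (1 / 2) * (Real.log (Q + 2) - Real.log t + 2 - 2 / (Q + 1)) := by
  have hm' : (1 : ℝ) ≤ m := by exact_mod_cast hm
  -- The induction starts at the least `Q` allowed by `htQ`. There, if `t ≥ 3`, no source exceeds
  -- `t`; if `t ≤ 2`, only the `m` edges of the vertex 2 occur.
  obtain ⟨Q0, hQ0⟩ : ∃ Q0, Q0 = t - 2 := ⟨_, rfl⟩
  induction Q, (show Q0 ≤ Q by omega) using Nat.le_induction with
  | base =>
    have hlog : 0 ≤ (1 / 2) * (Real.log (Q0 + 2) - Real.log t + 2 - 2 / (Q0 + 1)) := by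
      have h1 : Real.log t ≤ Real.log (Q0 + 2) := by
        rcases Nat.eq_zero_or_pos t with rfl | h
        · simpa using Real.log_nonneg (by linarith [(Nat.cast_nonneg Q0 : (0 : ℝ) ≤ Q0)])
        · exact Real.log_le_log (by exact_mod_cast h) (by exact_mod_cast htQ)
      have h2 : 2 / ((Q0 : ℝ) + 1) ≤ 2 := by
        rw [div_le_iff₀ (by positivity)]
        linarith [(Nat.cast_nonneg Q0 : (0 : ℝ) ≤ Q0)]
      linarith
    refine le_trans ?_ (le_add_of_nonneg_right hlog)
    rcases Nat.eq_zero_or_pos Q0 with h0 | h0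
    · subst h0
      calc _ ≤ ∑ i ∈ Finset.range (m * (0 + 1)), (1 : ℝ) := by
            refine Finset.sum_le_sum fun i hi => ?_
            have hi' : i < m := by simpa using hi
            unfold rate
            rw [if_pos hi']
            split_ifs <;> norm_num
        _ = m := by simp
    · rw [Finset.sum_eq_zero fun i hi => if_neg ?_]
      · positivity
      · have := (source_le_iff hm i (Q0 + 1)).2 (Finset.mem_range.1 hi)
        omega
  | succ Q hQ ih =>
    have ih := ih (by omega)
    have hq : (0 : ℝ) < (Q : ℝ) + 1 := by positivity
    rw [show m * (Q + 1 + 1) = m * (Q + 1) + m by ring, Finset.sum_range_add]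
    have hblock : ∑ i ∈ Finset.range m,
        (if t < source m (m * (Q + 1) + i) then rate m (m * (Q + 1) + i) else 0)
          ≤ 1 / (2 * ((Q : ℝ) + 1)) := by
      calc _ ≤ ∑ i ∈ Finset.range m, 1 / (2 * (m * ((Q : ℝ) + 1))) := by
            refine Finset.sum_le_sum fun i hi => ?_
            have hi' : i < m := Finset.mem_range.1 hi
            have hdiv : (m * (Q + 1) + i) / m = Q + 1 := by
              rw [Nat.mul_add_div hm, Nat.div_eq_of_lt hi', add_zero]
            have hge : ¬ m * (Q + 1) + i < m := by nlinarith
            unfold rate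
            rw [if_neg hge, hdiv]
            push_cast
            split_ifs
            · exact le_rfl
            · positivity
        _ = _ := by
            rw [Finset.sum_const, Finset.card_range, nsmul_eq_mul]
            field_simp
    have hlog : 1 / ((Q : ℝ) + 3) ≤ Real.log (Q + 3) - Real.log (Q + 2) := by
      rw [← Real.log_div (by positivity) (by positivity)]
      have := Real.one_sub_inv_le_log_of_pos (show 0 < ((Q : ℝ) + 3) / (Q + 2) by positivity)
      refine le_trans (le_of_eq ?_) this
      field_simp
      ring
    have halg : 1 / ((Q : ℝ) + 1) ≤ 1 / ((Q : ℝ) + 3) + (2 / (Q + 1) - 2 / (Q + 2)) := by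
      rw [← sub_nonneg]
      have : 1 / ((Q : ℝ) + 3) + (2 / (Q + 1) - 2 / (Q + 2)) - 1 / ((Q : ℝ) + 1)
          = 2 / ((Q + 1) * (Q + 2) * (Q + 3)) := by
        field_simp
        ring
      rw [this]
      positivity
    have hhalf : 1 / (2 * ((Q : ℝ) + 1)) = (1 / 2) * (1 / ((Q : ℝ) + 1)) := by field_simp
    push_cast
    rw [show (Q : ℝ) + 1 + 2 = Q + 3 by ring, show (Q : ℝ) + 1 + 1 = Q + 2 by ring]
    linarith

theorem sum_rate_le {m : ℕ} (hm : 1 ≤ m) {t e : ℕ} (ht : t < source m e) :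
    ∑ i ∈ Finset.range e, (if t < source m i then rate m i else 0) ≤
      (m + 1) + (1 / 2) * (Real.log (source m e) - Real.log t) := by
  have he : e < m * (e / m + 1) := (source_le_iff hm e _).1 le_rfl
  calc _ ≤ ∑ i ∈ Finset.range (m * (e / m + 1)), (if t < source m i then rate m i else 0) := by
        refine Finset.sum_le_sum_of_subset_of_nonneg
          (fun i hi => Finset.mem_range.2 ((Finset.mem_range.1 hi).trans he)) fun i _ _ => ?_
        split_ifs
        · exact rate_nonneg m i
        · exact le_rfl
    _ ≤ _ := sum_rate_block hm t (e / m) (by unfold source at ht; omega)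
    _ ≤ _ := by
        have h : 0 ≤ 2 / (((e / m : ℕ) : ℝ) + 1) := by positivity
        unfold source
        push_cast
        linarith

theorem rate_le {m : ℕ} (hm : 1 ≤ m) (e : ℕ) : rate m e ≤ 2 / source m e := by
  have hm' : (1 : ℝ) ≤ m := by exact_mod_cast hm
  unfold rate source
  split_ifs with h
  · rw [Nat.div_eq_of_lt h]; norm_num
  · have hq : (1 : ℝ) ≤ ((e / m : ℕ) : ℝ) := by
      exact_mod_cast (Nat.one_le_div_iff hm).2 (by omega)
    push_cast at hq ⊢
    rw [div_le_div_iff₀ (by positivity) (by positivity)]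
    nlinarith

/-- The exponent of the bound for the probability that the edge `p` is present. -/
noncomputable def edgeCost (c : ℝ) (m : ℕ) (p : ℕ × ℕ) : ℝ :=
  (1 / 2) * (Real.log (source m p.1) + Real.log p.2) +
    c * (Real.log (source m p.1) - Real.log p.2)

/-- Write `s` for the source and `t` for the target. The edge itself costs `rate`, at most `2 / s`;
while it is pending and `t` exists, the exponentials multiply to at most a constant times `(s / t) ^
(β / 2)`. The product `s⁻¹ (s / t) ^ (β / 2)` is exactly `exp (-edgeCost)` at `c = (1 - β) / 2`. -/
theorem prod_stepFactor_le {m : ℕ} (hm : 1 ≤ m) {β : ℝ} (hβ0 : 0 ≤ β) (hβ1 : β ≤ 1) {p : ℕ × ℕ}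
    (h1 : 1 ≤ p.2) (h2 : p.2 < source m p.1) {N : ℕ} (hN : p.1 ≤ N) :
    ∏ i ∈ Finset.range N, stepFactor β m (i + 1) p ≤
      2 * Real.exp (m + 1) * Real.exp (-edgeCost ((1 - β) / 2) m p) := by
  obtain ⟨j, t⟩ := p
  simp only at h1 h2 hN ⊢
  have ht0 : (0 : ℝ) < t := by exact_mod_cast h1
  have hs0 : (0 : ℝ) < source m j := by exact_mod_cast (by omega : 0 < source m j)
  have hlogts : Real.log t ≤ Real.log (source m j) :=
    Real.log_le_log ht0 (by exact_mod_cast h2.le)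
  have hcost : Real.exp (-edgeCost ((1 - β) / 2) m (j, t)) =
      (1 / source m j) * Real.exp (β / 2 * (Real.log (source m j) - Real.log t)) := by
    have : (1 : ℝ) / source m j = Real.exp (-Real.log (source m j)) := by
      rw [Real.exp_neg, Real.exp_log hs0, one_div]
    rw [this, ← Real.exp_add]
    congr 1
    unfold edgeCost
    ring
  have hm1 : (1 : ℝ) ≤ Real.exp (m + 1) := Real.one_le_exp (by positivity)
  have hE : (1 : ℝ) ≤ Real.exp (β / 2 * (Real.log (source m j) - Real.log t)) :=
    Real.one_le_exp (mul_nonneg (by linarith) (by linarith))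
  rw [hcost]
  -- The edge number `0` is deterministic and has no step factor; since its source is 2, the
  -- constant covers its nominal cost.
  rcases j with _ | j
  · have : ∀ i ∈ Finset.range N, stepFactor β m (i + 1) (0, t) = 1 := fun i _ => by
      simp [stepFactor]
    rw [Finset.prod_congr rfl this, Finset.prod_const_one]
    have hs : ((source m 0 : ℕ) : ℝ) = 2 := by simp [source]
    rw [hs] at hE ⊢
    nlinarith
  · have hprod : ∏ i ∈ Finset.range N, stepFactor β m (i + 1) (j + 1, t) ≤
        rate m (j + 1) * Real.exp (β * ∑ i ∈ Finset.range (j + 1),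
          (if t < source m i then rate m i else 0)) := by
      have hr := rate_nonneg m
      have hmem : j ∈ Finset.range N := Finset.mem_range.2 (by omega)
      rw [← Finset.mul_prod_erase _ _ hmem]
      have h0 : stepFactor β m (j + 1) (j + 1, t) = rate m (j + 1) := if_pos rfl
      rw [h0]
      refine mul_le_mul_of_nonneg_left ?_ (hr _)
      -- Step factors start at the edge number 1. The term of the sum at 0 is extra and only loosens
      -- the bound.
      rw [Finset.sum_range_succ', mul_add, Real.exp_add, Finset.mul_sum, Real.exp_sum]
      refine le_trans (le_of_eq ?_) (le_mul_of_one_le_right (by positivity)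
        (Real.one_le_exp (mul_nonneg hβ0 (by split_ifs <;> simp [hr]))))
      have hsub : Finset.range j ⊆ (Finset.range N).erase j := fun i hi => by
        have := Finset.mem_range.1 hi
        exact Finset.mem_erase.2 ⟨by omega, Finset.mem_range.2 (by omega)⟩
      rw [← Finset.prod_subset hsub]
      · refine Finset.prod_congr rfl fun i hi => ?_
        have := Finset.mem_range.1 hi
        unfold stepFactor
        rw [if_neg (by simp only; omega)]
        by_cases h : t < source m (i + 1)
        · rw [if_pos ⟨by simp only; omega, h⟩, if_pos h]
        · rw [if_neg (fun h' => h h'.2), if_neg h, mul_zero, Real.exp_zero]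
      · intro i hi hi'
        have h3 := Finset.ne_of_mem_erase hi
        have h4 : ¬ i < j := fun h => hi' (Finset.mem_range.2 h)
        unfold stepFactor
        rw [if_neg (by simp only; omega), if_neg (by simp only; omega)]
    refine hprod.trans ?_
    have hsum := sum_rate_le hm h2
    have hmβ : β * ((m : ℝ) + 1) ≤ m + 1 := mul_le_of_le_one_left (by positivity) hβ1
    calc _ ≤ (2 / source m (j + 1)) * Real.exp ((m + 1) +
            β / 2 * (Real.log (source m (j + 1)) - Real.log t)) := by
          refine mul_le_mul (rate_le hm _) (Real.exp_le_exp.2 ?_) (Real.exp_pos _).le (by positivity)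
          have := mul_le_mul_of_nonneg_left hsum hβ0
          linarith
      _ = _ := by rw [Real.exp_add]; ring

/-- The factor in the bound for the probability that `k` given edges are present. -/
noncomputable def occursConst (m k : ℕ) : ℝ :=
  (2 * m + 1 + k : ℝ) ^ k * (2 * Real.exp (m + 1)) ^ k

/-- The probability that all edges in `F` are present is at most the product of the bounds for the
single edges, up to a factor that depends on the number of edges only. -/
theorem law_occurs_le (α : unitInterval) {m : ℕ} (hm : 1 ≤ m)
    {F : Finset (ℕ × ℕ)} (hF : Set.InjOn Prod.fst (F : Set (ℕ × ℕ)))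
    (hF' : ∀ p ∈ F, 1 ≤ p.2 ∧ p.2 < source m p.1) :
    (law α m).real (occurs m F) ≤
      occursConst m F.card * Real.exp (-∑ p ∈ F, edgeCost (α / 2) m p) := by
  refine (law_occurs_le_prod α hm hF (e := F.sup Prod.fst) fun p hp =>
    Finset.le_sup (f := Prod.fst) hp).trans ?_
  have hconst : (2 * Real.exp (m + 1)) ^ F.card = ∏ _p ∈ F, 2 * Real.exp ((m : ℝ) + 1) :=
    (Finset.prod_const _).symm
  rw [occursConst, mul_assoc, ← Finset.sum_neg_distrib, Real.exp_sum, hconst,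
    ← Finset.prod_mul_distrib]
  refine mul_le_mul_of_nonneg_left (Finset.prod_le_prod (fun p _ => Finset.prod_nonneg fun i _ =>
    stepFactor_nonneg _ _ _ _) fun p hp => ?_) (by positivity)
  have h := prod_stepFactor_le hm (sub_nonneg.2 α.2.2) (by linarith [α.2.1]) (hF' p hp).1
    (hF' p hp).2 (Finset.le_sup (f := Prod.fst) hp)
  rwa [sub_sub_cancel] at h

/-! ### Excess configurations and the first-moment bound -/

/-- The ends of the edges in `F`, which are given by their numbers and targets. -/
def ends (m : ℕ) (F : Finset (ℕ × ℕ)) : Finset ℕ :=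
  F.image (fun p => source m p.1) ∪ F.image Prod.snd

/-- The degree of `v` in the multigraph formed by the edges in `F`. -/
def edgeDegree (m : ℕ) (F : Finset (ℕ × ℕ)) (v : ℕ) : ℕ :=
  ∑ p ∈ F, ((if source m p.1 = v then 1 else 0) + if p.2 = v then 1 else 0)

/-- A set of at most `M` possible edges of `G_n` that has `n` as an end and forms a multigraph of
minimal degree at least two with a vertex `w` of degree at least three, such that the edges
bridge the gap between `w` and `n` on the logarithmic scale. -/
structure IsExcessConfig (m M n : ℕ) (F : Finset (ℕ × ℕ)) : Prop where
  injOn : Set.InjOn Prod.fst (F : Set (ℕ × ℕ))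
  target_pos : ∀ p ∈ F, 1 ≤ p.2
  target_lt : ∀ p ∈ F, p.2 < source m p.1
  source_le : ∀ p ∈ F, source m p.1 ≤ n
  card_le : F.card ≤ M
  mem_ends : n ∈ ends m F
  two_le : ∀ v ∈ ends m F, 2 ≤ edgeDegree m F v
  exists_three_le : ∃ w ∈ ends m F, 3 ≤ edgeDegree m F w ∧
    Real.log n - Real.log w ≤ ∑ p ∈ F, (Real.log (source m p.1) - Real.log p.2)

/-- Weighted handshake identity, by double counting. -/
theorem sum_ends_degree_mul (m : ℕ) (F : Finset (ℕ × ℕ)) (f : ℕ → ℝ) :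
    ∑ p ∈ F, (f (source m p.1) + f p.2) = ∑ v ∈ ends m F, (edgeDegree m F v : ℝ) * f v := by
  simp only [edgeDegree, Nat.cast_sum, Finset.sum_mul]
  rw [Finset.sum_comm]
  refine Finset.sum_congr rfl fun p hp => ?_
  have h1 : source m p.1 ∈ ends m F :=
    Finset.mem_union_left _ (Finset.mem_image_of_mem (fun p : ℕ × ℕ => source m p.1) hp)
  have h2 : p.2 ∈ ends m F := Finset.mem_union_right _ (Finset.mem_image_of_mem _ hp)
  simp only [Nat.cast_add, Nat.cast_ite, Nat.cast_one, Nat.cast_zero, add_mul, ite_mul, one_mul,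
    zero_mul]
  rw [Finset.sum_add_distrib, Finset.sum_ite_eq, Finset.sum_ite_eq, if_pos h1, if_pos h2]

namespace IsExcessConfig

variable {m M n : ℕ} {F : Finset (ℕ × ℕ)}

theorem ends_subset (h : IsExcessConfig m M n F) : ends m F ⊆ Finset.Icc 1 n := by
  intro v hv
  rw [Finset.mem_Icc]
  rcases Finset.mem_union.1 hv with hv | hv
  · obtain ⟨p, hp, rfl⟩ := Finset.mem_image.1 hv
    exact ⟨by simp [source], h.source_le p hp⟩
  · obtain ⟨p, hp, rfl⟩ := Finset.mem_image.1 hv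
    exact ⟨h.target_pos p hp, (h.target_lt p hp).le.trans (h.source_le p hp)⟩

theorem card_ends_le (h : IsExcessConfig m M n F) : (ends m F).card ≤ 2 * M := by
  have h1 := Finset.card_union_le (F.image fun p => source m p.1) (F.image Prod.snd)
  have h2 : (F.image fun p => source m p.1).card ≤ F.card := Finset.card_image_le
  have h3 : (F.image Prod.snd).card ≤ F.card := Finset.card_image_le
  have h4 := h.card_le
  unfold ends
  omega

/-- The symmetric half of the cost is half the degree-weighted sum of logarithms, so it is at least
`∑ log v` plus `(log w) / 2` for the surplus degree of `w`. The other half is at least `c (log n -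
log w)`, and `c ≤ 1 / 2` lets the surplus cover the loss `c log w`. -/
theorem le_sum_edgeCost (h : IsExcessConfig m M n F) {c : ℝ} (hc0 : 0 ≤ c) (hc1 : c ≤ 1 / 2) :
    ∑ v ∈ ends m F, Real.log v + c * Real.log n ≤ ∑ p ∈ F, edgeCost c m p := by
  obtain ⟨w, hw, hw3, hlog⟩ := h.exists_three_le
  have hpos : ∀ v ∈ ends m F, 0 ≤ Real.log v := fun v _ => Real.log_natCast_nonneg v
  have hdeg : 2 * ∑ v ∈ ends m F, Real.log v + Real.log w ≤
      ∑ v ∈ ends m F, (edgeDegree m F v : ℝ) * Real.log v := by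
    rw [← Finset.add_sum_erase _ _ hw, ← Finset.add_sum_erase _ (fun v =>
      (edgeDegree m F v : ℝ) * Real.log v) hw, mul_add, Finset.mul_sum]
    have h1 : ∑ v ∈ (ends m F).erase w, 2 * Real.log v ≤
        ∑ v ∈ (ends m F).erase w, (edgeDegree m F v : ℝ) * Real.log v :=
      Finset.sum_le_sum fun v hv => by
        have hv := Finset.mem_of_mem_erase hv
        have h2 : (2 : ℝ) ≤ edgeDegree m F v := by exact_mod_cast h.two_le v hv
        exact mul_le_mul_of_nonneg_right h2 (hpos v hv)
    have h2 : 3 * Real.log w ≤ (edgeDegree m F w : ℝ) * Real.log w :=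
      mul_le_mul_of_nonneg_right (by exact_mod_cast hw3) (hpos w hw)
    linarith
  rw [← sum_ends_degree_mul m F fun v => Real.log v] at hdeg
  have hsum : ∑ p ∈ F, edgeCost c m p =
      (1 / 2) * ∑ p ∈ F, (Real.log (source m p.1) + Real.log p.2) +
        c * ∑ p ∈ F, (Real.log (source m p.1) - Real.log p.2) := by
    rw [Finset.mul_sum, Finset.mul_sum, ← Finset.sum_add_distrib]
    rfl
  rw [hsum]
  have h1 := mul_le_mul_of_nonneg_left hlog hc0
  have h2 : c * Real.log w ≤ 1 / 2 * Real.log w := mul_le_mul_of_nonneg_right hc1 (hpos w hw)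
  linarith

theorem mem_powerset (hm : 1 ≤ m) (h : IsExcessConfig m M n F) :
    F ∈ (Finset.range (m * n) ×ˢ Finset.Icc 1 n).powerset := by
  refine Finset.mem_powerset.2 fun p hp => Finset.mem_product.2 ⟨?_, ?_⟩
  · exact Finset.mem_range.2 ((source_le_iff hm _ _).1 ((h.source_le p hp).trans n.le_succ))
  · exact Finset.mem_Icc.2 ⟨h.target_pos p hp, (h.target_lt p hp).le.trans (h.source_le p hp)⟩

end IsExcessConfig

/-- Each end sends only `m` edges, so only boundedly many configurations share a vertex set of
bounded size. -/
theorem subset_edges_product_ends {m : ℕ} (hm : 1 ≤ m) (F : Finset (ℕ × ℕ)) :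
    F ⊆ (ends m F).biUnion (fun v => Finset.Ico (m * (v - 2)) (m * (v - 2) + m)) ×ˢ ends m F := by
  intro p hp
  refine Finset.mem_product.2 ⟨Finset.mem_biUnion.2 ⟨source m p.1,
    Finset.mem_union_left _ (Finset.mem_image_of_mem (fun p : ℕ × ℕ => source m p.1) hp), ?_⟩,
    Finset.mem_union_right _ (Finset.mem_image_of_mem _ hp)⟩
  have h1 := Nat.div_add_mod p.1 m
  have h2 := Nat.mod_lt p.1 hm
  simp only [source, Nat.add_sub_cancel, Finset.mem_Ico]
  omega

/-- Rankin's trick: `|U| ≤ K` and `L ≤ 1` give `1 ≤ L⁻¹ ^ K * L ^ |U|`. Then the size restriction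
can be dropped, and the sum over all `U` is `∏ (1 + L / v) ≤ exp (L * (1 + log n))`. The vertex `n`,
always present, contributes `n⁻¹`. -/
theorem sum_prod_inv_le {L : ℝ} (hL0 : 0 < L) (hL1 : L ≤ 1) (K n : ℕ) (hn : 1 ≤ n) :
    ∑ V ∈ (Finset.Icc 1 n).powerset with n ∈ V ∧ V.card ≤ K, ∏ v ∈ V, (v : ℝ)⁻¹ ≤
      L⁻¹ ^ K * Real.exp L * (n : ℝ) ^ (L - 1) := by
  classical
  have hn0 : (0 : ℝ) < n := by exact_mod_cast hn
  have hnot : n ∉ Finset.Icc 1 (n - 1) := by rw [Finset.mem_Icc]; omega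
  have hins : Finset.Icc 1 n = insert n (Finset.Icc 1 (n - 1)) := by
    ext v; simp only [Finset.mem_Icc, Finset.mem_insert]; omega
  rw [Finset.sum_filter, hins, Finset.sum_powerset_insert hnot, Finset.sum_eq_zero, zero_add]
  swap
  · exact fun U hU => if_neg fun h => hnot (Finset.mem_powerset.1 hU h.1)
  have hterm : ∀ U ∈ (Finset.Icc 1 (n - 1)).powerset,
      (if n ∈ insert n U ∧ (insert n U).card ≤ K then ∏ v ∈ insert n U, (v : ℝ)⁻¹ else 0) ≤
        (n : ℝ)⁻¹ * L⁻¹ ^ K * ∏ v ∈ U, L / v := by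
    intro U hU
    split_ifs with h
    · have hnU : n ∉ U := fun h => hnot (Finset.mem_powerset.1 hU h)
      have hcard : U.card ≤ K := (Finset.card_le_card (Finset.subset_insert n U)).trans h.2
      have hone : 1 ≤ L⁻¹ ^ K * L ^ U.card := by
        obtain ⟨d, rfl⟩ := Nat.exists_eq_add_of_le hcard
        rw [pow_add, mul_right_comm, ← mul_pow, inv_mul_cancel₀ hL0.ne', one_pow, one_mul]
        exact one_le_pow₀ ((one_le_inv₀ hL0).2 hL1)
      have hprod : ∏ v ∈ U, L / (v : ℝ) = L ^ U.card * ∏ v ∈ U, (v : ℝ)⁻¹ := by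
        simp only [div_eq_mul_inv, Finset.prod_mul_distrib, Finset.prod_const]
      have hU0 : 0 ≤ ∏ v ∈ U, (v : ℝ)⁻¹ := Finset.prod_nonneg fun v _ => by positivity
      rw [Finset.prod_insert hnU, hprod, mul_assoc]
      refine mul_le_mul_of_nonneg_left ?_ (by positivity)
      rw [← mul_assoc]
      exact le_mul_of_one_le_left hU0 hone
    · exact mul_nonneg (by positivity) (Finset.prod_nonneg fun v _ => by positivity)
  refine (Finset.sum_le_sum hterm).trans ?_
  rw [← Finset.mul_sum, ← Finset.prod_one_add]
  have hexp : ∏ v ∈ Finset.Icc 1 (n - 1), (1 + L / (v : ℝ)) ≤ Real.exp L * (n : ℝ) ^ L := by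
    calc _ ≤ ∏ v ∈ Finset.Icc 1 (n - 1), Real.exp (L / (v : ℝ)) :=
          Finset.prod_le_prod (fun v _ => by positivity) fun v _ => by
            rw [add_comm]; exact Real.add_one_le_exp _
      _ = Real.exp (L * ∑ v ∈ Finset.Icc 1 (n - 1), (v : ℝ)⁻¹) := by
          rw [Finset.mul_sum, Real.exp_sum]; simp only [div_eq_mul_inv]
      _ ≤ Real.exp (L * (1 + Real.log n)) := by
          refine Real.exp_le_exp.2 (mul_le_mul_of_nonneg_left ?_ hL0.le)
          calc _ ≤ ∑ v ∈ Finset.Icc 1 n, (v : ℝ)⁻¹ :=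
                Finset.sum_le_sum_of_subset_of_nonneg (Finset.Icc_subset_Icc_right (by omega))
                  fun v _ _ => by positivity
            _ = ((harmonic n : ℚ) : ℝ) := by rw [harmonic_eq_sum_Icc]; push_cast; rfl
            _ ≤ _ := harmonic_le_one_add_log n
      _ = _ := by
          rw [Real.rpow_def_of_pos hn0, ← Real.exp_add]; ring_nf
  calc _ ≤ (n : ℝ)⁻¹ * L⁻¹ ^ K * (Real.exp L * (n : ℝ) ^ L) :=
        mul_le_mul_of_nonneg_left hexp (by positivity)
    _ = _ := by
        rw [Real.rpow_sub hn0, Real.rpow_one]; ring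

/-- The event that some excess configuration is present. -/
def excessEvent (m M n : ℕ) : Set (Attachments m) :=
  {ω | ∃ F, IsExcessConfig m M n F ∧ ω ∈ occurs m F}

/-- Union bound over configurations, grouped by vertex set: `le_sum_edgeCost` bounds each term by a
function of the vertex set, and `sum_prod_inv_le` sums it. -/
theorem law_excessEvent_le (α : unitInterval) {m : ℕ} (hm : 1 ≤ m) (M : ℕ) {L : ℝ} (hL0 : 0 < L)
    (hL1 : L ≤ 1) :
    ∃ C : ℝ, ∀ n : ℕ, 1 ≤ n →
      (law α m).real (excessEvent m M n) ≤ C * (n : ℝ) ^ (L - 1 - α / 2) := by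
  classical
  set A : ℝ := ∑ k ∈ Finset.range (M + 1), occursConst m k with hA
  have hconst : ∀ k, 0 ≤ occursConst m k := fun k => by unfold occursConst; positivity
  have hA0 : 0 ≤ A := Finset.sum_nonneg fun k _ => hconst k
  refine ⟨A * (2 ^ (2 * M * m * (2 * M)) * (L⁻¹ ^ (2 * M) * Real.exp L)), fun n hn => ?_⟩
  have hn0 : (0 : ℝ) < n := by exact_mod_cast hn
  set S : Finset (Finset (ℕ × ℕ)) :=
    (Finset.range (m * n) ×ˢ Finset.Icc 1 n).powerset.filter (IsExcessConfig m M n) with hS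
  have hSmem : ∀ F, F ∈ S ↔ IsExcessConfig m M n F := fun F =>
    ⟨fun h => (Finset.mem_filter.1 h).2, fun h => Finset.mem_filter.2 ⟨h.mem_powerset hm, h⟩⟩
  have hsub : excessEvent m M n ⊆ ⋃ F ∈ S, occurs m F := by
    rintro ω ⟨F, hF, hω⟩
    exact Set.mem_biUnion ((hSmem F).2 hF) hω
  have hF : ∀ F ∈ S, (law α m).real (occurs m F) ≤
      A * (n : ℝ) ^ (-(α / 2 : ℝ)) * ∏ v ∈ ends m F, (v : ℝ)⁻¹ := by
    intro F hF
    have hF := (hSmem F).1 hF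
    refine (law_occurs_le α hm hF.injOn fun p hp => ⟨hF.target_pos p hp, hF.target_lt p hp⟩).trans ?_
    have h1 : occursConst m F.card ≤ A := Finset.single_le_sum (f := occursConst m)
      (fun k _ => hconst k) (Finset.mem_range.2 (Nat.lt_succ_of_le hF.card_le))
    have h2 := hF.le_sum_edgeCost (c := α / 2) (by linarith [α.2.1]) (by linarith [α.2.2])
    rw [mul_assoc]
    refine mul_le_mul h1 ?_ (Real.exp_pos _).le hA0
    calc _ ≤ Real.exp (-(∑ v ∈ ends m F, Real.log v + α / 2 * Real.log n)) :=
          Real.exp_le_exp.2 (by linarith)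
      _ = _ := by
          rw [neg_add_rev, Real.exp_add, Real.rpow_def_of_pos hn0, ← Finset.sum_neg_distrib,
            Real.exp_sum]
          congr 1
          · congr 1; ring
          · refine Finset.prod_congr rfl fun v hv => ?_
            have := (Finset.mem_Icc.1 (hF.ends_subset hv)).1
            rw [Real.exp_neg, Real.exp_log (by exact_mod_cast this)]
  have hmaps : ∀ F ∈ S, ends m F ∈
      (Finset.Icc 1 n).powerset.filter fun V => n ∈ V ∧ V.card ≤ 2 * M := fun F hF => by
    have hF := (hSmem F).1 hF
    exact Finset.mem_filter.2 ⟨Finset.mem_powerset.2 hF.ends_subset, hF.mem_ends, hF.card_ends_le⟩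
  -- There are at most `2M * m` possible edge numbers and `2M` possible targets.
  have hfib : ∀ V ∈ (Finset.Icc 1 n).powerset.filter fun V => n ∈ V ∧ V.card ≤ 2 * M,
      ((S.filter fun F => ends m F = V).card : ℝ) ≤ 2 ^ (2 * M * m * (2 * M)) := by
    intro V hV
    have hV := (Finset.mem_filter.1 hV).2.2
    have h1 : (V.biUnion fun v => Finset.Ico (m * (v - 2)) (m * (v - 2) + m)).card ≤ V.card * m :=
      Finset.card_biUnion_le_card_mul _ _ _ fun v _ => by simp
    have h2 : (S.filter fun F => ends m F = V).card ≤
        ((V.biUnion fun v => Finset.Ico (m * (v - 2)) (m * (v - 2) + m)) ×ˢ V).powerset.card := by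
      refine Finset.card_le_card fun F hF => Finset.mem_powerset.2 ?_
      rw [← (Finset.mem_filter.1 hF).2]
      exact subset_edges_product_ends hm F
    rw [Finset.card_powerset, Finset.card_product] at h2
    have h3 : (S.filter fun F => ends m F = V).card ≤ 2 ^ (2 * M * m * (2 * M)) :=
      h2.trans (Nat.pow_le_pow_right (by norm_num)
        (Nat.mul_le_mul (h1.trans (Nat.mul_le_mul_right _ hV)) hV))
    exact_mod_cast h3
  calc (law α m).real (excessEvent m M n)
      ≤ (law α m).real (⋃ F ∈ S, occurs m F) := measureReal_mono hsub (measure_ne_top _ _)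
    _ ≤ ∑ F ∈ S, (law α m).real (occurs m F) := measureReal_biUnion_finset_le _ _
    _ ≤ ∑ F ∈ S, A * (n : ℝ) ^ (-(α / 2 : ℝ)) * ∏ v ∈ ends m F, (v : ℝ)⁻¹ :=
        Finset.sum_le_sum hF
    _ = A * (n : ℝ) ^ (-(α / 2 : ℝ)) *
          ∑ V ∈ (Finset.Icc 1 n).powerset with n ∈ V ∧ V.card ≤ 2 * M,
            ∑ F ∈ S with ends m F = V, ∏ v ∈ V, (v : ℝ)⁻¹ := by
        rw [← Finset.mul_sum, ← Finset.sum_fiberwise_of_maps_to hmaps]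
        congr 1
        refine Finset.sum_congr rfl fun V _ => Finset.sum_congr rfl fun F hF => ?_
        rw [(Finset.mem_filter.1 hF).2]
    _ ≤ A * (n : ℝ) ^ (-(α / 2 : ℝ)) * (2 ^ (2 * M * m * (2 * M)) *
          (L⁻¹ ^ (2 * M) * Real.exp L * (n : ℝ) ^ (L - 1))) := by
        refine mul_le_mul_of_nonneg_left ?_ (by positivity)
        refine le_trans ?_ (mul_le_mul_of_nonneg_left (sum_prod_inv_le hL0 hL1 (2 * M) n hn)
          (by positivity))
        rw [Finset.mul_sum]
        refine Finset.sum_le_sum fun V hV => ?_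
        rw [Finset.sum_const, nsmul_eq_mul]
        exact mul_le_mul_of_nonneg_right (hfib V hV) (Finset.prod_nonneg fun v _ => by positivity)
    _ = _ := by
        rw [sub_eq_add_neg (L - 1), Real.rpow_add hn0]
        ring

/-! ### Two close cycles span an excess set -/

section Multigraph

variable {V E : Type*} {G : Graph V E}

/-- The vertices that are ends of the edges in `C`. -/
def endSet (G : Graph V E) (C : Set E) : Set V := {x | ∃ e ∈ C, G.Inc e x}

/-- The sets of vertices that contain, with one end of an edge in `C`, the other one. -/
def ClosedUnder (G : Graph V E) (C : Set E) (X : Set V) : Prop :=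
  ∀ e ∈ C, ∀ x y, G.IsLink e x y → x ∈ X → y ∈ X

theorem ClosedUnder.mono {C C' : Set E} (h : C ⊆ C') {X : Set V} (hX : ClosedUnder G C' X) :
    ClosedUnder G C X := fun e he => hX e (h he)

namespace IsCycleOfLength

variable {l : ℕ} {C : Set E}

theorem finite (h : IsCycleOfLength G l C) : C.Finite := by
  obtain ⟨hl, v, e, -, -, -, rfl⟩ := h
  have : NeZero l := ⟨by omega⟩
  exact Set.finite_range e

theorem ncard_le (h : IsCycleOfLength G l C) : C.ncard ≤ l := by
  obtain ⟨hl, v, e, -, -, -, rfl⟩ := h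
  have : NeZero l := ⟨by omega⟩
  rw [← Set.image_univ]
  refine (Set.ncard_image_le Set.finite_univ).trans ?_
  rw [Set.ncard_univ, Nat.card_zmod]

theorem exists_isLink (h : IsCycleOfLength G l C) {e : E} (he : e ∈ C) :
    ∃ x y, G.IsLink e x y := by
  obtain ⟨hl, v, e, -, -, hlink, rfl⟩ := h
  obtain ⟨i, rfl⟩ := he
  exact ⟨_, _, hlink i⟩

theorem endSet_nonempty (h : IsCycleOfLength G l C) : (endSet G C).Nonempty := by
  obtain ⟨hl, v, e, -, -, hlink, rfl⟩ := h
  exact ⟨v 0, e 0, ⟨0, rfl⟩, _, hlink 0⟩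

theorem exists_two_edges (hG : ∀ e x, ¬ G.IsLink e x x) (h : IsCycleOfLength G l C) {x : V}
    (hx : x ∈ endSet G C) : ∃ e ∈ C, ∃ e' ∈ C, e ≠ e' ∧ G.Inc e x ∧ G.Inc e' x := by
  obtain ⟨hl, v, e, hv, he, hlink, rfl⟩ := h
  have hl2 : 2 ≤ l := by
    by_contra hlt
    obtain rfl : l = 1 := by omega
    have := hlink 0
    rw [Subsingleton.elim (0 + 1 : ZMod 1) 0] at this
    exact hG _ _ this
  have : Fact (1 < l) := ⟨hl2⟩
  obtain ⟨_, ⟨i, rfl⟩, y, hy⟩ := hx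
  have key : ∀ j, x = v j → ∃ e1 ∈ Set.range e, ∃ e2 ∈ Set.range e,
      e1 ≠ e2 ∧ G.Inc e1 x ∧ G.Inc e2 x := by
    rintro j rfl
    refine ⟨e j, ⟨j, rfl⟩, e (j - 1), ⟨j - 1, rfl⟩, fun h => ?_, ⟨_, hlink j⟩, ⟨v (j - 1), ?_⟩⟩
    · have := he h
      rw [eq_sub_iff_add_eq, add_eq_left] at this
      exact one_ne_zero this
    · have := hlink (j - 1)
      rw [sub_add_cancel] at this
      exact this.symm
  rcases G.eq_or_eq_of_isLink_of_isLink hy (hlink i) with h | h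
  · exact key _ h
  · exact key _ h

/-- Going round the cycle, closedness carries membership from one vertex to all of them. -/
theorem endSet_subset (h : IsCycleOfLength G l C) {X : Set V} (hX : ClosedUnder G C X) {x : V}
    (hx : x ∈ endSet G C) (hxX : x ∈ X) : endSet G C ⊆ X := by
  obtain ⟨hl, v, e, hv, he, hlink, rfl⟩ := h
  have : NeZero l := ⟨by omega⟩
  have hends : ∀ y ∈ endSet G (Set.range e), ∃ j, y = v j := by
    rintro y ⟨_, ⟨i, rfl⟩, z, hz⟩
    rcases G.eq_or_eq_of_isLink_of_isLink hz (hlink i) with h | h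
    · exact ⟨_, h⟩
    · exact ⟨_, h⟩
  obtain ⟨j, rfl⟩ := hends x hx
  have hstep : ∀ k : ℕ, v (j + k) ∈ X := by
    intro k
    induction k with
    | zero => simpa using hxX
    | succ k ih =>
      have := hX _ ⟨j + k, rfl⟩ _ _ (hlink (j + k)) ih
      rwa [add_assoc, ← Nat.cast_succ] at this
  intro y hy
  obtain ⟨i, rfl⟩ := hends y hy
  obtain ⟨k, hk⟩ := ZMod.natCast_zmod_surjective (i - j)
  have := hstep k
  rwa [hk, add_sub_cancel] at this

/-- Otherwise the ends of `D` are closed under `C`, so all vertices of the cycle are ends of `D`;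
then every edge of `C` lies in `D`. -/
theorem exists_inc_notMem (h : IsCycleOfLength G l C) {D : Set E} (hCD : ¬ C ⊆ D) {x : V}
    (hxC : x ∈ endSet G C) (hxD : x ∈ endSet G D) :
    ∃ w ∈ endSet G D, ∃ e ∈ C, e ∉ D ∧ G.Inc e w := by
  by_contra! hcon
  have hX : ClosedUnder G C (endSet G D) := by
    intro e he y z hyz hy
    by_contra hz
    have heD : e ∈ D := by
      by_contra h
      exact hcon y hy e he h ⟨z, hyz⟩
    exact hz ⟨e, heD, y, hyz.symm⟩
  have hsub := h.endSet_subset hX hxC hxD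
  refine hCD fun e he => ?_
  by_contra hD
  obtain ⟨y, z, hyz⟩ := h.exists_isLink he
  exact hcon y (hsub ⟨e, he, z, hyz⟩) e he hD ⟨z, hyz⟩

end IsCycleOfLength

/-- The first `k` steps of `u` form a walk of `G` from an end of an edge of `A` to an end of an edge
of `B`. -/
structure IsBridge (G : Graph V E) (A B : Set E) (k : ℕ) (u : ℕ → V) : Prop where
  left : u 0 ∈ endSet G A
  right : u k ∈ endSet G B
  adj : ∀ i < k, (simpleGraph G).Adj (u i) (u (i + 1))

theorem cycleDist_le_iff {A B : Set E} {r : ℕ} :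
    cycleDist G A B ≤ r ↔ ∃ k ≤ r, ∃ u, IsBridge G A B k u := by
  constructor
  · intro h
    -- A strict bound lets the infimum be unfolded into witnesses.
    have h' : cycleDist G A B < (r + 1 : ℕ) :=
      lt_of_le_of_lt h (by exact_mod_cast Nat.lt_succ_self r)
    simp only [cycleDist, iInf_lt_iff] at h'
    obtain ⟨x, hx, y, hy, hxy⟩ := h'
    obtain ⟨p, hp⟩ := SimpleGraph.exists_walk_of_edist_ne_top (ne_top_of_lt hxy)
    refine ⟨p.length, ?_, p.getVert, ?_, ?_, ?_⟩
    · rw [← hp] at hxy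
      have : p.length < r + 1 := by exact_mod_cast hxy
      omega
    · simpa [endSet] using hx
    · simpa [endSet] using hy
    · exact fun i hi => p.adj_getVert_succ hi
  · rintro ⟨k, hk, u, hu⟩
    have hwalk : ∀ j ≤ k, ∃ p : (simpleGraph G).Walk (u 0) (u j), p.length = j := by
      intro j
      induction j with
      | zero => exact fun _ => ⟨.nil, rfl⟩
      | succ j ih =>
        intro hj
        obtain ⟨p, hp⟩ := ih (by omega)
        exact ⟨p.concat (hu.adj j (by omega)), by simp [hp]⟩
    obtain ⟨p, hp⟩ := hwalk k le_rfl
    calc cycleDist G A B ≤ (simpleGraph G).edist (u 0) (u k) :=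
          iInf₂_le_of_le (u 0) hu.left (iInf₂_le (u k) hu.right)
      _ ≤ p.length := p.edist_le
      _ ≤ r := by rw [hp]; exact_mod_cast hk

namespace IsBridge

variable {A B : Set E} {k : ℕ} {u : ℕ → V}

/-- Otherwise dropping the first `i` steps gives a shorter bridge. -/
theorem notMem_left (hu : IsBridge G A B k u)
    (hmin : ∀ k' u', IsBridge G A B k' u' → k ≤ k') {i : ℕ} (hi : 0 < i) (hik : i ≤ k) :
    u i ∉ endSet G A := by
  intro h
  have := hmin (k - i) (fun j => u (i + j)) ⟨h, by
    rw [Nat.add_sub_cancel' hik]; exact hu.right, fun j hj => hu.adj (i + j) (by omega)⟩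
  omega

/-- Otherwise cutting out the two steps gives a shorter bridge. -/
theorem ne_add_two (hu : IsBridge G A B k u)
    (hmin : ∀ k' u', IsBridge G A B k' u' → k ≤ k') {i : ℕ} (hik : i + 2 ≤ k) :
    u i ≠ u (i + 2) := by
  intro h
  obtain ⟨u', hdef⟩ : ∃ u' : ℕ → V, ∀ j, u' j = if j < i then u j else u (j + 2) :=
    ⟨_, fun _ => rfl⟩
  have hge : ∀ j, i ≤ j → u' j = u (j + 2) := fun j hj => by rw [hdef, if_neg (by omega)]
  have hle : ∀ j, j ≤ i → u' j = u j := by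
    intro j hj
    rcases hj.lt_or_eq with hj | rfl
    · rw [hdef, if_pos hj]
    · rw [hge j le_rfl, h]
  have := hmin (k - 2) u' ⟨?_, ?_, fun j hj => ?_⟩
  · omega
  · rw [hle 0 (Nat.zero_le _)]; exact hu.left
  · rw [hge _ (by omega), Nat.sub_add_cancel (by omega)]; exact hu.right
  · by_cases hji : j < i
    · rw [hle j hji.le, hle (j + 1) hji]; exact hu.adj j (by omega)
    · rw [hge j (by omega), hge (j + 1) (by omega)]
      exact hu.adj (j + 2) (by omega)

end IsBridge

/-- A finite connected set of edges that has minimal degree at least two, and a vertex of degree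
at least three. -/
structure IsExcessSet (G : Graph V E) (F : Finset E) : Prop where
  exists_isLink : ∀ e ∈ F, ∃ x y, G.IsLink e x y
  exists_two : ∀ x ∈ endSet G F, ∃ e ∈ F, ∃ e' ∈ F, e ≠ e' ∧ G.Inc e x ∧ G.Inc e' x
  exists_three : ∃ w, ∃ e ∈ F, ∃ e' ∈ F, ∃ e'' ∈ F, e ≠ e' ∧ e ≠ e'' ∧ e' ≠ e'' ∧
    G.Inc e w ∧ G.Inc e' w ∧ G.Inc e'' w
  connected : ∀ X, ClosedUnder G F X → ∀ x ∈ endSet G F, x ∈ X → endSet G F ⊆ X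

/-- The set is the union of both cycles and a shortest bridge, with at most `2r + 2r + r` edges.
Cycle vertices have two cycle edges, and inner bridge vertices have two bridge edges, which differ
because a shortest bridge does not turn back. A vertex of degree three lies where the bridge leaves
`A`, or where one cycle leaves the other if they meet. -/
theorem exists_isExcessSet (hG : ∀ e x, ¬ G.IsLink e x x) {r k : ℕ} {A B : Set E}
    (hA : A ∈ shortCycles G r) (hB : B ∈ shortCycles G r) (hAB : A ≠ B) {u : ℕ → V}
    (hu : IsBridge G A B k u) (hmin : ∀ k' u', IsBridge G A B k' u' → k ≤ k') (hk : k ≤ r) :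
    ∃ F : Finset E, F.card ≤ 5 * r ∧ IsExcessSet G F ∧ endSet G A ⊆ endSet G F ∧
      ∀ i ≤ k, u i ∈ endSet G F := by
  classical
  obtain ⟨a, ha, hA⟩ := hA
  obtain ⟨b, hb, hB⟩ := hB
  have hadj : ∀ i, ∃ e, i < k → G.IsLink e (u i) (u (i + 1)) := by
    intro i
    by_cases hi : i < k
    · obtain ⟨-, e, he⟩ := hu.adj i hi
      exact ⟨e, fun _ => he⟩
    -- Beyond the end of the bridge any edge serves as a default.
    · obtain ⟨e, -⟩ := hu.left
      exact ⟨e, fun h => absurd h hi⟩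
  choose p hp using hadj
  set F : Finset E := hA.finite.toFinset ∪ hB.finite.toFinset ∪ (Finset.range k).image p with hF
  have hAF : A ⊆ F := fun e he => by simp [hF, he]
  have hBF : B ⊆ F := fun e he => by simp [hF, he]
  have hpF : ∀ i < k, p i ∈ F := fun i hi => by
    rw [hF]
    exact Finset.mem_union_right _ (Finset.mem_image_of_mem _ (Finset.mem_range.2 hi))
  have hFcases : ∀ e ∈ F, e ∈ A ∨ e ∈ B ∨ ∃ i < k, p i = e := by
    intro e he
    simp only [hF, Finset.mem_union, Set.Finite.mem_toFinset, Finset.mem_image,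
      Finset.mem_range] at he
    tauto
  have hends : ∀ x ∈ endSet G (F : Set E), x ∈ endSet G A ∨ x ∈ endSet G B ∨ ∃ i ≤ k, x = u i := by
    rintro x ⟨e, he, hx⟩
    rcases hFcases e he with h | h | ⟨i, hi, rfl⟩
    · exact Or.inl ⟨e, h, hx⟩
    · exact Or.inr (Or.inl ⟨e, h, hx⟩)
    · obtain ⟨y, hy⟩ := hx
      rcases G.eq_or_eq_of_isLink_of_isLink hy (hp i hi) with h | h
      · exact Or.inr (Or.inr ⟨i, hi.le, h⟩)
      · exact Or.inr (Or.inr ⟨i + 1, hi, h⟩)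
  have hmono : ∀ {C : Set E}, C ⊆ F → endSet G C ⊆ endSet G F :=
    fun h x ⟨e, he, hx⟩ => ⟨e, h he, hx⟩
  have hpath : ∀ i ≤ k, u i ∈ endSet G (F : Set E) := by
    intro i hi
    rcases hi.lt_or_eq with hi | rfl
    · exact ⟨p i, hpF i hi, _, hp i hi⟩
    · exact hmono hBF hu.right
  refine ⟨F, ?_, ⟨?_, ?_, ?_, ?_⟩, hmono hAF, hpath⟩
  · have h1 : hA.finite.toFinset.card ≤ 2 * r := by
      rw [← Set.ncard_eq_toFinset_card A hA.finite]; exact hA.ncard_le.trans ha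
    have h2 : hB.finite.toFinset.card ≤ 2 * r := by
      rw [← Set.ncard_eq_toFinset_card B hB.finite]; exact hB.ncard_le.trans hb
    have h3 : ((Finset.range k).image p).card ≤ k :=
      Finset.card_image_le.trans (Finset.card_range k).le
    have h4 := Finset.card_union_le (hA.finite.toFinset ∪ hB.finite.toFinset)
      ((Finset.range k).image p)
    have h5 := Finset.card_union_le hA.finite.toFinset hB.finite.toFinset
    rw [← hF] at h4
    omega
  · intro e he
    rcases hFcases e he with h | h | ⟨i, hi, rfl⟩
    · exact hA.exists_isLink h
    · exact hB.exists_isLink h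
    · exact ⟨_, _, hp i hi⟩
  · have htwoA : ∀ x ∈ endSet G A, ∃ e ∈ F, ∃ e' ∈ F, e ≠ e' ∧ G.Inc e x ∧ G.Inc e' x := by
      intro x hx
      obtain ⟨e, he, e', he', h⟩ := hA.exists_two_edges hG hx
      exact ⟨e, hAF he, e', hAF he', h⟩
    have htwoB : ∀ x ∈ endSet G B, ∃ e ∈ F, ∃ e' ∈ F, e ≠ e' ∧ G.Inc e x ∧ G.Inc e' x := by
      intro x hx
      obtain ⟨e, he, e', he', h⟩ := hB.exists_two_edges hG hx
      exact ⟨e, hBF he, e', hBF he', h⟩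
    intro x hx
    rcases hends x hx with h | h | ⟨i, hi, rfl⟩
    · exact htwoA x h
    · exact htwoB x h
    · rcases Nat.eq_zero_or_pos i with rfl | hi0
      · exact htwoA _ hu.left
      · rcases hi.lt_or_eq with hik | rfl
        · obtain ⟨i, rfl⟩ : ∃ j, i = j + 1 := ⟨i - 1, by omega⟩
          have h1 := hp i (by omega)
          have h2 := hp (i + 1) hik
          refine ⟨p i, hpF i (by omega), p (i + 1), hpF _ hik, fun h => ?_, ⟨_, h1.symm⟩, ⟨_, h2⟩⟩
          rw [← h] at h2
          rcases G.eq_or_eq_of_isLink_of_isLink h1 h2 with h3 | h3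
          · exact (hu.adj i (by omega)).1 h3
          · exact hu.ne_add_two hmin hik h3
        · exact htwoB _ hu.right
  · rcases Nat.eq_zero_or_pos k with rfl | hk0
    · have hthree : ∀ {C D : Set E} {c d : ℕ}, C ⊆ F → D ⊆ F → IsCycleOfLength G c C →
          IsCycleOfLength G d D → ¬ C ⊆ D → u 0 ∈ endSet G C → u 0 ∈ endSet G D →
          ∃ w, ∃ e ∈ F, ∃ e' ∈ F, ∃ e'' ∈ F, e ≠ e' ∧ e ≠ e'' ∧ e' ≠ e'' ∧
            G.Inc e w ∧ G.Inc e' w ∧ G.Inc e'' w := by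
        intro C D c d hCF hDF hC hD hCD h1 h2
        obtain ⟨w, hw, e, he, heD, hew⟩ := hC.exists_inc_notMem hCD h1 h2
        obtain ⟨e', he', e'', he'', hne, hew', hew''⟩ := hD.exists_two_edges hG hw
        exact ⟨w, e, hCF he, e', hDF he', e'', hDF he'', fun h => heD (h ▸ he'),
          fun h => heD (h ▸ he''), hne, hew, hew', hew''⟩
      -- Distinct cycles cannot contain each other both ways, so one of them has an edge outside the
      -- other.
      by_cases h : A ⊆ B
      · exact hthree hBF hAF hB hA (fun h' => hAB (h.antisymm h')) hu.right hu.left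
      · exact hthree hAF hBF hA hB h hu.left hu.right
    · obtain ⟨e, he, e', he', hne, h1, h2⟩ := hA.exists_two_edges hG hu.left
      have h3 := hp 0 hk0
      have hpA : p 0 ∉ A := fun h =>
        hu.notMem_left hmin zero_lt_one hk0 ⟨_, h, _, h3.symm⟩
      exact ⟨u 0, e, hAF he, e', hAF he', p 0, hpF 0 hk0, hne, fun h => hpA (h ▸ he),
        fun h => hpA (h ▸ he'), h1, h2, _, h3⟩
  · intro X hX x hx hxX
    have hfwd : ∀ i ≤ k, (u i ∈ X ↔ u 0 ∈ X) := by
      intro i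
      induction i with
      | zero => exact fun _ => Iff.rfl
      | succ i ih =>
        intro hi
        rw [← ih (by omega)]
        have h := hp i hi
        exact ⟨hX _ (hpF i hi) _ _ h.symm, hX _ (hpF i hi) _ _ h⟩
    have hu0 : u 0 ∈ X := by
      rcases hends x hx with h | h | ⟨i, hi, rfl⟩
      · exact hA.endSet_subset (hX.mono hAF) h hxX hu.left
      · exact (hfwd k le_rfl).1 (hB.endSet_subset (hX.mono hBF) h hxX hu.right)
      · exact (hfwd i hi).1 hxX
    intro y hy
    rcases hends y hy with h | h | ⟨i, hi, rfl⟩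
    · exact hA.endSet_subset (hX.mono hAF) hu.left hu0 h
    · exact hB.endSet_subset (hX.mono hBF) hu.right ((hfwd k le_rfl).2 hu0) h
    · exact (hfwd i hi).2 hu0

/-- The differences telescope along the path. A path repeats no edge, since the first vertex would
reappear in the tail, so the sum runs over a set of edges. -/
theorem sub_le_sum_of_isPath {H : SimpleGraph V} {F : Finset E} {f : V → ℝ} {d : E → ℝ}
    (hH : ∀ x y, H.Adj x y → ∃ e ∈ F, G.IsLink e x y)
    (hd : ∀ e ∈ F, ∀ x y, G.IsLink e x y → f x - f y ≤ d e) {x y : V} (p : H.Walk x y)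
    (hp : p.IsPath) :
    ∃ F' ⊆ F, (∀ e ∈ F', ∀ z, G.Inc e z → z ∈ p.support) ∧ f x - f y ≤ ∑ e ∈ F', d e := by
  classical
  induction p with
  | nil => exact ⟨∅, by simp, by simp, by simp⟩
  | @cons a b c hab q ih =>
    rw [SimpleGraph.Walk.cons_isPath_iff] at hp
    obtain ⟨F', hF', hsupp, hsum⟩ := ih hp.1
    obtain ⟨e, he, hlink⟩ := hH a b hab
    have heF' : e ∉ F' := fun h => hp.2 (hsupp e h a ⟨b, hlink⟩)
    refine ⟨insert e F', Finset.insert_subset he hF', ?_, ?_⟩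
    · intro e' he' z hz
      rw [SimpleGraph.Walk.support_cons, List.mem_cons]
      rcases Finset.mem_insert.1 he' with rfl | he'
      · obtain ⟨y, hy⟩ := hz
        rcases G.eq_or_eq_of_isLink_of_isLink hy hlink with h | h
        · exact Or.inl h
        · exact Or.inr (h ▸ q.start_mem_support)
      · exact Or.inr (hsupp e' he' z hz)
    · rw [Finset.sum_insert heF']
      have := hd e he a b hlink
      linarith

/-- In a connected set of edges, the difference of the values of a function at two vertices is at
most the sum of its variations along the edges. -/
theorem IsExcessSet.sub_le_sum {F : Finset E} (hF : IsExcessSet G F) {f : V → ℝ} {d : E → ℝ}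
    (hd : ∀ e ∈ F, ∀ x y, G.IsLink e x y → f x - f y ≤ d e) {x y : V} (hx : x ∈ endSet G F)
    (hy : y ∈ endSet G F) : f x - f y ≤ ∑ e ∈ F, d e := by
  classical
  let H : SimpleGraph V := {
    Adj := fun x y => x ≠ y ∧ ∃ e ∈ F, G.IsLink e x y
    symm := ⟨fun _ _ h => ⟨h.1.symm, h.2.imp fun _ he => ⟨he.1, he.2.symm⟩⟩⟩
    loopless := ⟨fun _ h => h.1 rfl⟩ }
  have hreach : H.Reachable x y := by
    refine hF.connected {z | H.Reachable x z} ?_ x hx (SimpleGraph.Reachable.refl x) hy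
    intro e he a b hab ha
    by_cases h : a = b
    · exact h ▸ ha
    · exact SimpleGraph.Reachable.trans ha (SimpleGraph.Adj.reachable ⟨h, e, he, hab⟩)
  obtain ⟨p, hp⟩ := hreach.exists_isPath
  obtain ⟨F', hF', -, hsum⟩ := sub_le_sum_of_isPath (H := H) (fun a b h => h.2) hd p hp
  -- Edges off the path only help: `hd` in both directions gives `0 ≤ d e`.
  refine hsum.trans (Finset.sum_le_sum_of_subset_of_nonneg hF' fun e he _ => ?_)
  obtain ⟨a, b, hab⟩ := hF.exists_isLink e he
  have h1 := hd e he a b hab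
  have h2 := hd e he b a hab.symm
  linarith

end Multigraph

/-! ### How a new multicycle arises when a multigraph grows -/

section Multigraph

variable {V E : Type*} {G G' : Graph V E}

theorem IsCycleOfLength.of_isLink {l : ℕ} {C : Set E} (h : IsCycleOfLength G l C)
    (hG : ∀ e ∈ C, ∀ x y, G.IsLink e x y → G'.IsLink e x y) : IsCycleOfLength G' l C := by
  obtain ⟨hl, v, e, hv, he, hlink, rfl⟩ := h
  exact ⟨hl, v, e, hv, he, fun i => hG _ ⟨i, rfl⟩ _ _ (hlink i), rfl⟩

theorem endSet_mono (hG : ∀ e x y, G.IsLink e x y → G'.IsLink e x y) (C : Set E) :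
    endSet G C ⊆ endSet G' C := fun _ ⟨e, he, y, hy⟩ => ⟨e, he, y, hG e _ y hy⟩

theorem IsBridge.mono (hG : ∀ e x y, G.IsLink e x y → G'.IsLink e x y) {A B : Set E} {k : ℕ}
    {u : ℕ → V} (h : IsBridge G A B k u) : IsBridge G' A B k u :=
  ⟨endSet_mono hG A h.left, endSet_mono hG B h.right,
    fun i hi => ⟨(h.adj i hi).1, (h.adj i hi).2.imp fun e he => hG e _ _ he⟩⟩

theorem cycleDist_le_of_isLink_imp (hG : ∀ e x y, G.IsLink e x y → G'.IsLink e x y) {A B : Set E}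
    {r : ℕ} (h : cycleDist G A B ≤ r) : cycleDist G' A B ≤ r := by
  rw [cycleDist_le_iff] at h ⊢
  obtain ⟨k, hk, u, hu⟩ := h
  exact ⟨k, hk, u, hu.mono hG⟩

theorem cycleDist_le_of_mem {A B : Set E} {x : V} (hA : x ∈ endSet G A) (hB : x ∈ endSet G B)
    (r : ℕ) : cycleDist G A B ≤ r :=
  cycleDist_le_iff.2 ⟨0, Nat.zero_le _, fun _ => x, hA, hB, fun _ h => absurd h (Nat.not_lt_zero _)⟩

theorem IsBridge.symm {A B : Set E} {k : ℕ} {u : ℕ → V} (h : IsBridge G A B k u) :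
    IsBridge G B A k fun i => u (k - i) := by
  refine ⟨by simpa using h.right, by simpa using h.left, fun i hi => ?_⟩
  have := h.adj (k - (i + 1)) (by omega)
  rw [show k - (i + 1) + 1 = k - i by omega] at this
  exact this.symm

theorem Linked.symm {r : ℕ} {A B : Set E} (h : Linked G r A B) : Linked G r B A := by
  induction h with
  | refl => exact Relation.ReflTransGen.refl
  | tail _ hstep ih =>
    obtain ⟨k, hk, u, hu⟩ := cycleDist_le_iff.1 hstep.2.2
    exact ih.head ⟨hstep.2.1, hstep.1, cycleDist_le_iff.2 ⟨k, hk, _, hu.symm⟩⟩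

/-- If no other short cycle is near `A`, a chain from `A` never leaves `A`. -/
theorem Linked.exists_ne {r : ℕ} {A B : Set E} (h : Linked G r A B) (hne : A ≠ B) :
    ∃ C, C ≠ A ∧ A ∈ shortCycles G r ∧ C ∈ shortCycles G r ∧ cycleDist G A C ≤ r := by
  by_contra! hcon
  have : ∀ C, Linked G r A C → C = A := by
    intro C hC
    induction hC with
    | refl => rfl
    | tail _ hstep ih =>
      subst ih
      by_contra hne
      exact absurd hstep.2.2 (not_le.2 (hcon _ hne hstep.1 hstep.2.1))
  exact hne (this B h).symm

/-- A multicycle of `G'` that is not a multicycle of `G` contains a short cycle that is new or two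
short cycles that have come closer. -/
theorem exists_of_mem_multicycles (hG : ∀ e x y, G.IsLink e x y → G'.IsLink e x y) {r : ℕ}
    {S : Set E} (hS : S ∈ multicycles G' r) (hS' : S ∉ multicycles G r) :
    ∃ A ∈ shortCycles G' r, ∃ B ∈ shortCycles G' r, A ≠ B ∧ cycleDist G' A B ≤ r ∧
      (A ∉ shortCycles G r ∨
        A ∈ shortCycles G r ∧ B ∈ shortCycles G r ∧ ¬ cycleDist G A B ≤ r) := by
  obtain ⟨⟨C, hC, rfl⟩, hiso⟩ := hS
  obtain ⟨D, hD, hCD, hDC⟩ : ∃ D ∈ shortCycles G' r, Linked G' r C D ∧ D ≠ C := by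
    by_contra! hcon
    have hclass : {C' | C' ∈ shortCycles G' r ∧ Linked G' r C C'} = {C} := by
      ext C'
      exact ⟨fun h => hcon C' h.1 h.2, by
        rintro rfl
        exact ⟨hC, Relation.ReflTransGen.refl⟩⟩
    rw [hclass, Set.sUnion_singleton] at hiso
    refine hiso ⟨hC, fun C' hC' hne => ?_⟩
    by_contra hle
    exact hne (hcon C' hC' (Relation.ReflTransGen.single ⟨hC, hC', not_lt.1 hle⟩))
  have hother : ∀ A, Linked G' r C A → ∃ B, Linked G' r A B ∧ A ≠ B := by
    intro A hA
    by_cases h : A = C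
    · exact ⟨D, hA.symm.trans hCD, h ▸ hDC.symm⟩
    · exact ⟨C, hA.symm, h⟩
  by_cases hnew : ∃ A, Linked G' r C A ∧ A ∉ shortCycles G r
  · obtain ⟨A, hA, hA'⟩ := hnew
    obtain ⟨B, hAB, hne⟩ := hother A hA
    obtain ⟨B', hne', h1, h2, h3⟩ := hAB.exists_ne hne
    exact ⟨A, h1, B', h2, hne'.symm, h3, Or.inl hA'⟩
  push Not at hnew
  by_contra! hcon
  have hshort : shortCycles G r ⊆ shortCycles G' r := fun A ⟨l, hl, hA⟩ =>
    ⟨l, hl, hA.of_isLink fun e _ => hG e⟩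
  have hlink : ∀ A, Linked G' r C A → Linked G r C A := by
    intro A hA
    induction hA with
    | refl => exact Relation.ReflTransGen.refl
    | @tail A B hCA hstep ih =>
      by_cases hAB : A = B
      · exact hAB ▸ ih
      · have hA := hnew A hCA
        have hB := hnew B (hCA.tail hstep)
        exact ih.tail ⟨hA, hB, ((hcon A hstep.1 B hstep.2.1 hAB hstep.2.2).2) hA hB⟩
  have hlink' : ∀ A, Linked G r C A → Linked G' r C A := by
    intro A hA
    induction hA with
    | refl => exact Relation.ReflTransGen.refl
    | tail _ hstep ih =>
      exact ih.tail ⟨hshort hstep.1, hshort hstep.2.1, cycleDist_le_of_isLink_imp hG hstep.2.2⟩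
  have hclass : {C' | C' ∈ shortCycles G' r ∧ Linked G' r C C'}
      = {C' | C' ∈ shortCycles G r ∧ Linked G r C C'} := by
    ext A
    exact ⟨fun h => ⟨hnew A h.2, hlink A h.2⟩, fun h => ⟨hshort h.1, hlink' A h.2⟩⟩
  refine hS' ⟨⟨C, hnew C Relation.ReflTransGen.refl, by rw [hclass]⟩, fun hSiso => ?_⟩
  -- If the union of the class were an isolated cycle of `G`, every member would share a vertex with
  -- it and hence equal it, contradicting `C ≠ D`.
  have hkey : ∀ A, Linked G' r C A →
      A = ⋃₀ {C' | C' ∈ shortCycles G' r ∧ Linked G' r C C'} := by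
    intro A hA
    by_contra hne
    have hAs := hnew A hA
    refine absurd (hSiso.2 A hAs hne) (not_lt.2 ?_)
    obtain ⟨l, hl, hAc⟩ := hAs
    obtain ⟨x, e, he, hx⟩ := hAc.endSet_nonempty
    have hunion : e ∈ ⋃₀ {C' | C' ∈ shortCycles G' r ∧ Linked G' r C C'} :=
      ⟨A, ⟨hshort (hnew A hA), hA⟩, he⟩
    exact cycleDist_le_of_mem ⟨e, hunion, hx⟩ ⟨e, he, hx⟩ r
  exact hDC ((hkey D hCD).trans (hkey C Relation.ReflTransGen.refl).symm)

end Multigraph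

/-! ### Excess configurations in the attachment graph -/

section Attachments

variable {m : ℕ} {ω : Attachments m} {n : ℕ}

theorem graph_isLink_iff {e x y : ℕ} : (graph ω n).IsLink e x y ↔
    source m e ≤ n ∧ (x = source m e ∧ y = target (ω e) ∨ x = target (ω e) ∧ y = source m e) := by
  change _ ∧ _ ↔ _
  rw [Sym2.eq_iff]

theorem graph_not_isLink_self (e x : ℕ) : ¬ (graph ω n).IsLink e x x := by
  rw [graph_isLink_iff]
  have := target_lt_source (ω e)
  omega

theorem graph_inc_iff {e x : ℕ} : (graph ω n).Inc e x ↔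
    source m e ≤ n ∧ (x = source m e ∨ x = target (ω e)) := by
  constructor
  · rintro ⟨y, hy⟩
    rw [graph_isLink_iff] at hy
    exact ⟨hy.1, hy.2.imp And.left And.left⟩
  · rintro ⟨h, rfl | rfl⟩
    · exact ⟨_, graph_isLink_iff.2 ⟨h, Or.inl ⟨rfl, rfl⟩⟩⟩
    · exact ⟨_, graph_isLink_iff.2 ⟨h, Or.inr ⟨rfl, rfl⟩⟩⟩

theorem graph_isLink_mono {n' : ℕ} (hn : n ≤ n') (e x y : ℕ) (h : (graph ω n).IsLink e x y) :
    (graph ω n').IsLink e x y := ⟨h.1.trans hn, h.2⟩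

theorem graph_isLink_pred {e x y : ℕ} (h : (graph ω n).IsLink e x y) (hx : x ≠ n) (hy : y ≠ n) :
    (graph ω (n - 1)).IsLink e x y := by
  rw [graph_isLink_iff] at h ⊢
  omega

/-- Links that avoid `n` are already present in `G_{n-1}`. So a new short cycle passes through `n`,
and two old cycles can come closer only by a bridge through `n`. -/
theorem NewMulticycle.exists_bridge {r : ℕ} (h : NewMulticycle r ω n) :
    ∃ A ∈ shortCycles (graph ω n) r, ∃ B ∈ shortCycles (graph ω n) r, A ≠ B ∧
      ∃ k ≤ r, ∃ u, IsBridge (graph ω n) A B k u ∧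
        (∀ k' u', IsBridge (graph ω n) A B k' u' → k ≤ k') ∧
        (n ∈ endSet (graph ω n) A ∨ ∃ i ≤ k, u i = n) := by
  classical
  obtain ⟨S, hS, hS'⟩ := h
  have hmono := graph_isLink_mono (ω := ω) (Nat.sub_le n 1)
  obtain ⟨A, hA, B, hB, hAB, hdist, hcases⟩ := exists_of_mem_multicycles hmono hS hS'
  obtain ⟨k₀, hk₀, hu₀⟩ := cycleDist_le_iff.1 hdist
  have hex : ∃ k u, IsBridge (graph ω n) A B k u := ⟨k₀, hu₀⟩
  obtain ⟨u, hu⟩ := Nat.find_spec hex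
  have hkr : Nat.find hex ≤ r := (Nat.find_min' hex hu₀).trans hk₀
  refine ⟨A, hA, B, hB, hAB, Nat.find hex, hkr, u, hu, fun k' u' h' => Nat.find_min' hex ⟨u', h'⟩,
    ?_⟩
  rcases hcases with hnew | ⟨⟨a, ha, hA'⟩, ⟨b, hb, hB'⟩, hfar⟩
  · left
    by_contra hn
    obtain ⟨a, ha, hAc⟩ := hA
    refine hnew ⟨a, ha, hAc.of_isLink fun e he x y hxy => graph_isLink_pred hxy ?_ ?_⟩
    · rintro rfl
      exact hn ⟨e, he, y, hxy⟩
    · rintro rfl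
      exact hn ⟨e, he, x, hxy.symm⟩
  · right
    by_contra! hn
    have hends : ∀ {C : Set ℕ} {c : ℕ}, IsCycleOfLength (graph ω (n - 1)) c C →
        endSet (graph ω n) C ⊆ endSet (graph ω (n - 1)) C := by
      rintro C c hC x ⟨e, he, hx⟩
      obtain ⟨y, z, hyz⟩ := hC.exists_isLink he
      exact ⟨e, he, graph_inc_iff.2 ⟨hyz.1, (graph_inc_iff.1 hx).2⟩⟩
    refine hfar (cycleDist_le_iff.2 ⟨_, hkr, u, hends hA' hu.left, hends hB' hu.right,
      fun i hi => ?_⟩)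
    obtain ⟨hne, e, he⟩ := hu.adj i hi
    exact ⟨hne, e, graph_isLink_pred he (hn i hi.le) (hn (i + 1) hi)⟩

theorem card_le_edgeDegree {F : Finset ℕ} {v : ℕ} {s : Finset ℕ} (hs : s ⊆ F)
    (h : ∀ e ∈ s, (graph ω n).Inc e v) :
    s.card ≤ edgeDegree m (F.image fun e => (e, target (ω e))) v := by
  classical
  unfold edgeDegree
  rw [Finset.sum_image fun a _ b _ hab => (Prod.ext_iff.1 hab).1, Finset.card_eq_sum_ones]
  refine (Finset.sum_le_sum fun e he => ?_).trans (Finset.sum_le_sum_of_subset hs)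
  rcases (graph_inc_iff.1 (h e he)).2 with h | h
  · rw [if_pos h.symm]; exact Nat.le_add_right _ _
  · rw [if_pos h.symm]; exact Nat.le_add_left _ _

/-- The gap condition is `IsExcessSet.sub_le_sum` for the logarithm, whose variation along an edge
is `log source - log target` because targets are smaller than sources. -/
theorem IsExcessSet.isExcessConfig {F : Finset ℕ} (hF : IsExcessSet (graph ω n) F) {M : ℕ}
    (hM : F.card ≤ M) (hn : n ∈ endSet (graph ω n) F) :
    IsExcessConfig m M n (F.image fun e => (e, target (ω e))) := by
  classical
  have hlink : ∀ e ∈ F, source m e ≤ n := fun e he => by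
    obtain ⟨x, y, hxy⟩ := hF.exists_isLink e he
    exact hxy.1
  have hends : ∀ v, v ∈ ends m (F.image fun e => (e, target (ω e))) ↔
      v ∈ endSet (graph ω n) F := by
    intro v
    simp only [ends, Finset.mem_union, Finset.mem_image, endSet, graph_inc_iff]
    constructor
    · rintro (⟨p, ⟨e, he, rfl⟩, rfl⟩ | ⟨p, ⟨e, he, rfl⟩, rfl⟩)
      · exact ⟨e, he, hlink e he, Or.inl rfl⟩
      · exact ⟨e, he, hlink e he, Or.inr rfl⟩
    · rintro ⟨e, he, -, rfl | rfl⟩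
      · exact Or.inl ⟨_, ⟨e, he, rfl⟩, rfl⟩
      · exact Or.inr ⟨_, ⟨e, he, rfl⟩, rfl⟩
  constructor
  · intro p hp q hq hpq
    obtain ⟨e, -, rfl⟩ := Finset.mem_image.1 (Finset.mem_coe.1 hp)
    obtain ⟨e', -, rfl⟩ := Finset.mem_image.1 (Finset.mem_coe.1 hq)
    obtain rfl : e = e' := hpq
    rfl
  · intro p hp
    obtain ⟨e, -, rfl⟩ := Finset.mem_image.1 hp
    exact Nat.succ_pos _
  · intro p hp
    obtain ⟨e, -, rfl⟩ := Finset.mem_image.1 hp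
    exact target_lt_source _
  · intro p hp
    obtain ⟨e, he, rfl⟩ := Finset.mem_image.1 hp
    exact hlink e he
  · exact Finset.card_image_le.trans hM
  · exact (hends n).2 hn
  · intro v hv
    obtain ⟨e, he, e', he', hne, h1, h2⟩ := hF.exists_two v ((hends v).1 hv)
    rw [← Finset.card_pair hne]
    refine card_le_edgeDegree ?_ (n := n) ?_
    · simp [Finset.insert_subset_iff, he, he']
    · simp [h1, h2]
  · obtain ⟨w, e, he, e', he', e'', he'', h1, h2, h3, h4, h5, h6⟩ := hF.exists_three
    have hw : w ∈ endSet (graph ω n) F := ⟨e, he, h4⟩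
    refine ⟨w, (hends w).2 hw, ?_, ?_⟩
    · rw [← Finset.card_eq_three.2 ⟨e, e', e'', h1, h2, h3, rfl⟩]
      refine card_le_edgeDegree ?_ (n := n) ?_
      · simp [Finset.insert_subset_iff, he, he', he'']
      · simp [h4, h5, h6]
    · rw [Finset.sum_image fun a _ b _ hab => (Prod.ext_iff.1 hab).1]
      refine hF.sub_le_sum (f := fun v => Real.log v) ?_ hn hw
      intro e _ x y hxy
      have hlog : Real.log (target (ω e) : ℕ) ≤ Real.log (source m e) :=
        Real.log_le_log (by exact_mod_cast Nat.succ_pos _)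
          (by exact_mod_cast (target_lt_source (ω e)).le)
      rcases (graph_isLink_iff.1 hxy).2 with ⟨rfl, rfl⟩ | ⟨rfl, rfl⟩
      · exact le_rfl
      · simp only at hlog ⊢; linarith

theorem NewMulticycle.mem_excessEvent {r : ℕ} (h : NewMulticycle r ω n) :
    ω ∈ excessEvent m (5 * r) n := by
  classical
  obtain ⟨A, hA, B, hB, hAB, k, hk, u, hu, hmin, hn⟩ := h.exists_bridge
  obtain ⟨F, hcard, hF, hAF, huF⟩ :=
    exists_isExcessSet graph_not_isLink_self hA hB hAB hu hmin hk
  have hnF : n ∈ endSet (graph ω n) F := by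
    rcases hn with h | ⟨i, hi, h⟩
    · exact hAF h
    · exact h ▸ huF i hi
  refine ⟨_, hF.isExcessConfig hcard hnF, fun p hp => ?_⟩
  obtain ⟨e, -, rfl⟩ := Finset.mem_image.1 hp
  rfl

end Attachments

end PrefAttach

/-! ### Conclusion: decay and summability -/

open PrefAttach in
theorem lemma4p10 (α : unitInterval) (m r : ℕ) (hm : 1 ≤ m) :
    (∀ ε : ℝ, 0 < ε → ∃ N : ℕ, ∀ n : ℕ, N < n →
      (PrefAttach.law α m).real {ω | PrefAttach.NewMulticycle r ω n} < ε) ∧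
    (0 < α → ∀ ε : ℝ, 0 < ε → ∃ N : ℕ,
      (PrefAttach.law α m).real {ω | ∃ n : ℕ, N < n ∧ PrefAttach.NewMulticycle r ω n} < ε) := by
  have hα0 : (0 : ℝ) ≤ α := α.2.1
  have hα1 : (α : ℝ) ≤ 1 := α.2.2
  have hle : ∀ n, (law α m).real {ω | NewMulticycle r ω n} ≤
      (law α m).real (excessEvent m (5 * r) n) := fun n =>
    measureReal_mono (fun ω h => NewMulticycle.mem_excessEvent h) (measure_ne_top _ _)
  constructor
  · intro ε hε
    -- With `L = 1 / 2` the exponent is `-1/2 - α/2`, negative even for `α = 0`.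
    obtain ⟨C, hC⟩ := law_excessEvent_le α hm (5 * r) (L := 1 / 2) (by norm_num) (by norm_num)
    have htend : Filter.Tendsto (fun n : ℕ => C * (n : ℝ) ^ ((1 / 2 : ℝ) - 1 - α / 2))
        Filter.atTop (nhds 0) := by
      have h := (tendsto_rpow_neg_atTop (y := 1 / 2 + α / 2) (by positivity)).comp
        tendsto_natCast_atTop_atTop
      have h' := h.const_mul C
      rw [mul_zero] at h'
      refine h'.congr fun n => ?_
      simp only [Function.comp_apply]
      congr 2
      ring
    obtain ⟨N, hN⟩ := Filter.eventually_atTop.1 (htend.eventually_lt_const hε)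
    exact ⟨N, fun n hn => ((hle n).trans (hC n (by omega))).trans_lt (hN n hn.le)⟩
  · intro hα ε hε
    have hα' : (0 : ℝ) < α := hα
    -- With `L = α / 4` the exponent is `-1 - α/4`, below `-1`, so the bounds are summable and a
    -- union bound over the tail suffices.
    obtain ⟨C, hC⟩ := law_excessEvent_le α hm (5 * r) (L := α / 4) (by positivity) (by linarith)
    have hsum : Summable fun n : ℕ => C * (n : ℝ) ^ ((α / 4 : ℝ) - 1 - α / 2) :=
      (Real.summable_nat_rpow.2 (by linarith)).mul_left C
    have htail := tendsto_sum_nat_add fun n : ℕ => C * (n : ℝ) ^ ((α / 4 : ℝ) - 1 - α / 2)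
    obtain ⟨N, hN⟩ := Filter.eventually_atTop.1 (htail.eventually_lt_const hε)
    refine ⟨N, lt_of_le_of_lt ?_ (hN (N + 1) (Nat.le_succ N))⟩
    have hsub : {ω : Attachments m | ∃ n : ℕ, N < n ∧ NewMulticycle r ω n} ⊆
        ⋃ k : ℕ, {ω | NewMulticycle r ω (k + (N + 1))} := by
      rintro ω ⟨n, hn, hω⟩
      refine Set.mem_iUnion.2 ⟨n - (N + 1), ?_⟩
      change NewMulticycle r ω (n - (N + 1) + (N + 1))
      rwa [Nat.sub_add_cancel hn]
    have hsum' := (summable_nat_add_iff (N + 1)).2 hsum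
    have hb : ∀ k : ℕ, (law α m).real {ω | NewMulticycle r ω (k + (N + 1))} ≤
        C * ((k + (N + 1) : ℕ) : ℝ) ^ ((α / 4 : ℝ) - 1 - α / 2) := fun k =>
      (hle _).trans (hC _ (by omega))
    have hpos : ∀ k : ℕ, 0 ≤ C * ((k + (N + 1) : ℕ) : ℝ) ^ ((α / 4 : ℝ) - 1 - α / 2) := fun k =>
      measureReal_nonneg.trans (hb k)
    refine ENNReal.toReal_le_of_le_ofReal (tsum_nonneg hpos) ?_
    calc _ ≤ law α m (⋃ k : ℕ, {ω | NewMulticycle r ω (k + (N + 1))}) := measure_mono hsub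
      _ ≤ ∑' k : ℕ, law α m {ω | NewMulticycle r ω (k + (N + 1))} := measure_iUnion_le _
      _ ≤ ∑' k : ℕ, ENNReal.ofReal
            (C * ((k + (N + 1) : ℕ) : ℝ) ^ ((α / 4 : ℝ) - 1 - α / 2)) :=
          ENNReal.tsum_le_tsum fun k => by
            rw [← ofReal_measureReal (measure_ne_top _ _)]
            exact ENNReal.ofReal_le_ofReal (hb k)
      _ = _ := (ENNReal.ofReal_tsum_of_nonneg hpos hsum').symm
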